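/- Let $F_2=\langle a,b\rangle$ be the free group on two generators, let $L_2=\{a,b,a^{-1},b^{-1}\}$ be its set of letters, and let $|w|$ be the length of the reduced word of $w\in F_2$. An automorphic conjugacy class is an orbit $W$ of $\operatorname{Aut}F_2$ on $F_2$; a word $w$ is minimal if $|\phi(w)|\ge|w|$ for all $\phi\in\operatorname{Aut}F_2$. For a cyclically reduced $w=x_1\cdots x_n$ and a nonempty $u$ with $|u|=k\le n$, let $(u)_w$ be the number of occurrences of $u$ and $u^{-1}$ as contiguous subwords of $x_1\cdots x_nx_1\cdots x_{k-1}$, and let $(u)_w=0$ if $k>n$. A cyclically reduced word $w$ is a root word if $|(ab)_w-(ab^{-1})_w|=(aa)_w=(bb)_w$. A non-root class is an automorphic conjugacy class that contains no root word. A permutation is an automorphism of $F_2$ that permutes $L_2$. A one-letter automorphism is an automorphism $(\{y\},x)$ given by $x\mapsto x$, $y\mapsto yx$, where $x,y\in L_2$ and $y\notin\{x,x^{-1}\}$. Let $J\le\operatorname{Aut}F_2$ be generated by the inner automorphisms and the permutations, and let $[w]$ be the $J$-orbit of $w$. Let $\Gamma(W)$ be the directed multigraph whose vertices are the classes $[w]$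 of minimal words $w\in W$, with one edge from $[w]$ to $[v]$ for each class $[\phi]$, modulo inner automorphisms, of one-letter automorphisms $\phi$ with $\phi(w)\in[v]$ (the number of these does not depend on the representatives). Theorem. If $W$ is a non-root class, then for some $n\ge 0$ the graph $\Gamma(W)$ is isomorphic, as a directed multigraph, to one of the following graphs on the vertices $0,\dots,n$. (P1) The simple path: exactly one edge in each direction between $i$ and $i+1$ for $0\le i<n$, and no other edges (for $n=0$, a single vertex without edges). (P2) The looped path: the simple path together with one loop at the vertex $n$ (for $n=0$, a single vertex with one loop). (P3) The double-edged path: for $n\ge1$, the simple path together with a second edge from $n$ to $n-1$ (so two edges from $n$ to $n-1$ and one edge from $n-1$ to $n$); for $n=0$, a single vertex with two loops. -/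

import Mathlib

/-- The free group on two generators `a` and `b`. -/
abbrev F2 : Type := FreeGroup (Fin 2)

namespace F2

/-- The alphabet `{a, b, a⁻¹, b⁻¹}`: the pair `(i, true)` is the `i`-th generator and
`(i, false)` is its inverse. -/
abbrev Letter : Type := Fin 2 × Bool

/-- The inverse letter. -/
def Letter.bar (x : Letter) : Letter := (x.1, !x.2)

/-- A letter, as an element of the free group. -/
def Letter.elt (x : Letter) : F2 := FreeGroup.mk [x]

/-- The generator `a`. -/
def a : F2 := FreeGroup.of 0

/-- The generator `b`. -/
def b : F2 := FreeGroup.of 1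

/-- The length of the reduced word of `w`. -/
def length (w : F2) : ℕ := w.toWord.length

/-- `w` and `v` are automorphic conjugates. -/
def AutConj (w v : F2) : Prop := ∃ φ : MulAut F2, φ w = v

/-- An automorphic conjugacy class, that is, an equivalence class of `AutConj`. -/
def IsAutClass (W : Set F2) : Prop := ∃ w : F2, W = {v | AutConj w v}

/-- `w` is minimal: no automorphism makes it shorter. -/
def IsMinimal (w : F2) : Prop := ∀ φ : MulAut F2, length w ≤ length (φ w)

/-! ### Root words -/

/-- For a nonempty `u` with `k = |u| ≤ |w| = n`, the number of (possibly overlapping) occurrences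
of the words `u` and `u⁻¹` in `x₁ ⋯ xₙ x₁ ⋯ xₖ₋₁`, where `w = x₁ ⋯ xₙ`;
it is `0` if `|u| > |w|`. -/
def count (u w : F2) : ℕ :=
  if length u ≤ length w then
    ((Finset.range (length w)).filter fun i =>
      (((w.toWord ++ w.toWord.take (length u - 1)).drop i).take (length u) = u.toWord ∨
        ((w.toWord ++ w.toWord.take (length u - 1)).drop i).take (length u) = u⁻¹.toWord)).card
  else 0

/-- A root word: a cyclically reduced word `w` with
`|(ab)_w - (ab⁻¹)_w| = (aa)_w = (bb)_w`. -/
def IsRootWord (w : F2) : Prop :=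
  FreeGroup.IsCyclicallyReduced w.toWord ∧
    |(count (a * b) w : ℤ) - (count (a * b⁻¹) w : ℤ)| = (count (a * a) w : ℤ) ∧
    count (a * a) w = count (b * b) w

/-- An automorphic conjugacy class that contains no root word. -/
def IsNonRootClass (W : Set F2) : Prop := IsAutClass W ∧ ∀ w ∈ W, ¬ IsRootWord w

/-! ### Automorphisms -/

/-- The subgroup of inner automorphisms. -/
abbrev Inn : Subgroup (MulAut F2) := (MulAut.conj : F2 →* MulAut F2).range

/-- A permutation (Type I automorphism): an automorphism that permutes the letters. -/
def IsPermutation (π : MulAut F2) : Prop :=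
  π '' Set.range Letter.elt = Set.range Letter.elt

/-- `φ` is the Type II automorphism `(A, x)`, where `A` contains neither `x` nor `x⁻¹`:
it sends each letter `z` to `x⁻¹ ^ β(z⁻¹ ∈ A) * z * x ^ β(z ∈ A)`. -/
def IsTypeII (A : Finset Letter) (x : Letter) (φ : MulAut F2) : Prop :=
  x ∉ A ∧ x.bar ∉ A ∧ ∀ z : Letter,
    φ z.elt = (if z.bar ∈ A then x.elt⁻¹ else 1) * z.elt * (if z ∈ A then x.elt else 1)

/-- A one-letter automorphism: a Type II automorphism `(A, x)` with `|A| = 1`. -/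
def IsOneLetter (φ : MulAut F2) : Prop :=
  ∃ (A : Finset Letter) (x : Letter), A.card = 1 ∧ IsTypeII A x φ

/-- The subgroup generated by the inner automorphisms and the permutations. -/
def J : Subgroup (MulAut F2) :=
  Subgroup.closure ((Inn : Set (MulAut F2)) ∪ {π | IsPermutation π})

/-- `w ∼_J v`. -/
def JRel (w v : F2) : Prop := ∃ φ ∈ J, φ w = v

theorem JRel.refl (w : F2) : JRel w w := ⟨1, J.one_mem, rfl⟩

theorem JRel.symm {w v : F2} : JRel w v → JRel v w := by
  rintro ⟨φ, hφ, rfl⟩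
  exact ⟨φ⁻¹, J.inv_mem hφ, by simp⟩

theorem JRel.trans {u v w : F2} : JRel u v → JRel v w → JRel u w := by
  rintro ⟨φ, hφ, rfl⟩ ⟨ψ, hψ, rfl⟩
  exact ⟨ψ * φ, J.mul_mem hψ hφ, rfl⟩

/-! ### The graph -/

/-- The classes `[φ]` modulo inner automorphisms of the one-letter automorphisms `φ`
with `φ w ∼_J v`. -/
def edgeClasses (w v : F2) : Set (MulAut F2 ⧸ Inn) :=
  {c | ∃ φ : MulAut F2, IsOneLetter φ ∧ (φ : MulAut F2 ⧸ Inn) = c ∧ JRel (φ w) v}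

/-- The minimal words of `W`. -/
abbrev MinWord (W : Set F2) : Type := {w : F2 // w ∈ W ∧ IsMinimal w}

/-- `∼_J` on the minimal words of `W`. -/
instance minWordSetoid (W : Set F2) : Setoid (MinWord W) where
  r w v := JRel w.1 v.1
  iseqv := ⟨fun w => JRel.refl w.1, fun h => h.symm, fun h k => h.trans k⟩

/-- The vertices of `Γ(W)`: classes of minimal words of `W` modulo `J`. -/
abbrev Vertex (W : Set F2) : Type := Quotient (minWordSetoid W)

theorem bar_bar (x : Letter) : x.bar.bar = x := by simp [Letter.bar]

theorem bar_elt (x : Letter) : x.bar.elt = x.elt⁻¹ := by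
  simp [Letter.bar, Letter.elt, FreeGroup.inv_mk, FreeGroup.invRev]

theorem elt_injective : Function.Injective Letter.elt := by
  intro x y h
  have h2 := congrArg FreeGroup.toWord h
  simpa [Letter.elt, FreeGroup.toWord_mk] using h2

theorem IsPermutation.inv {π : MulAut F2} (h : IsPermutation π) : IsPermutation π⁻¹ := by
  unfold IsPermutation at *
  conv_lhs => rw [← h]
  rw [Set.image_image]
  simp

theorem IsPermutation.conj_oneLetter {π φ : MulAut F2} (h : IsPermutation π)
    (hφ : IsOneLetter φ) : IsOneLetter (π * φ * π⁻¹) := by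
  classical
  obtain ⟨A, x, hA, hx, hxb, hz⟩ := hφ
  have h1 : ∀ z : Letter, ∃ z' : Letter, z'.elt = π z.elt := fun z => by
    have : π z.elt ∈ π '' Set.range Letter.elt := ⟨_, ⟨z, rfl⟩, rfl⟩
    rw [h] at this
    exact this
  have h2 : ∀ z : Letter, ∃ z' : Letter, π z'.elt = z.elt := fun z => by
    have : z.elt ∈ Set.range Letter.elt := ⟨z, rfl⟩
    rw [← h] at this
    obtain ⟨_, ⟨y, rfl⟩, hy⟩ := this
    exact ⟨y, hy⟩
  choose σ hσ using h1
  have hσi : Function.Injective σ := fun y z hyz => by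
    have := hσ y
    rw [hyz, hσ z] at this
    exact (elt_injective (π.injective this)).symm
  have hσb : ∀ z, σ z.bar = (σ z).bar := fun z => by
    apply elt_injective
    rw [hσ, bar_elt, bar_elt, hσ, map_inv]
  refine ⟨A.image σ, σ x, ?_, ?_, ?_, ?_⟩
  · rw [Finset.card_image_of_injective _ hσi, hA]
  · rwa [hσi.mem_finset_image]
  · rwa [← hσb, hσi.mem_finset_image]
  · intro z
    obtain ⟨y, hy⟩ := h2 z
    have hyz : σ y = z := elt_injective (by rw [hσ, hy])
    subst hyz
    simp only [← hσb, hσi.mem_finset_image, hσ]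
    rw [MulAut.mul_apply, MulAut.mul_apply, show π⁻¹ (π y.elt) = y.elt by simp, hz, map_mul,
      map_mul]
    congr 1
    · congr 1
      split_ifs <;> simp
    · split_ifs <;> simp

theorem conj_inner_mem {c : MulAut F2} (hc : c ∈ Inn) (j : MulAut F2) :
    j * c * j⁻¹ ∈ Inn := by
  obtain ⟨g, rfl⟩ := hc
  refine ⟨j g, ?_⟩
  ext x
  simp [MulAut.conj_apply]

/-- Conjugation by an element of `J` maps one-letter automorphisms to one-letter automorphisms,
modulo inner automorphisms. -/
theorem conj_oneLetter {j : MulAut F2} (hj : j ∈ J) : ∀ φ : MulAut F2, IsOneLetter φ →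
    (∃ ψ, IsOneLetter ψ ∧ ψ⁻¹ * (j * φ * j⁻¹) ∈ Inn) := by
  have key : ∀ j ∈ ((Inn : Set (MulAut F2)) ∪ {π | IsPermutation π}), ∀ φ : MulAut F2,
      IsOneLetter φ → ∃ ψ, IsOneLetter ψ ∧ ψ⁻¹ * (j * φ * j⁻¹) ∈ Inn := by
    rintro j (hj | hj) φ hφ
    · refine ⟨φ, hφ, ?_⟩
      have h1 := conj_inner_mem hj φ⁻¹
      have h2 := Inn.mul_mem h1 (Inn.inv_mem hj)
      simpa [mul_assoc] using h2
    · exact ⟨_, hj.conj_oneLetter hφ, by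
        rw [inv_mul_cancel]
        exact Inn.one_mem⟩
  have mul : ∀ i j : MulAut F2,
      (∀ φ, IsOneLetter φ → ∃ ψ, IsOneLetter ψ ∧ ψ⁻¹ * (i * φ * i⁻¹) ∈ Inn) →
      (∀ φ, IsOneLetter φ → ∃ ψ, IsOneLetter ψ ∧ ψ⁻¹ * (j * φ * j⁻¹) ∈ Inn) →
      (∀ φ, IsOneLetter φ → ∃ ψ, IsOneLetter ψ ∧ ψ⁻¹ * (i * j * φ * (i * j)⁻¹) ∈ Inn) := by
    intro i j hi hj φ hφ
    obtain ⟨ψ, hψ, h1⟩ := hj φ hφ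
    obtain ⟨χ, hχ, h2⟩ := hi ψ hψ
    refine ⟨χ, hχ, ?_⟩
    have h3 := Inn.mul_mem h2 (conj_inner_mem h1 i)
    simpa [mul_assoc] using h3
  have gen : J.toSubmonoid =
      Submonoid.closure ((Inn : Set (MulAut F2)) ∪ {π | IsPermutation π}) := by
    unfold J
    rw [Subgroup.closure_toSubmonoid]
    congr 1
    refine Set.union_eq_self_of_subset_right ?_
    rintro j (hj | hj)
    · left
      simpa using Inn.inv_mem hj
    · right
      have h := IsPermutation.inv hj
      rwa [inv_inv] at h
  have hj' : j ∈ Submonoid.closure ((Inn : Set (MulAut F2)) ∪ {π | IsPermutation π}) := by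
    rw [← gen]
    exact hj
  clear hj
  induction hj' using Submonoid.closure_induction with
  | mem j h => exact key j h
  | one => exact key 1 (Or.inl Inn.one_mem)
  | mul i j hi hj ihi ihj =>
    exact mul i j ihi ihj

/-- Conjugation by `j`, on classes modulo inner automorphisms. -/
def conjClass (j : MulAut F2) : MulAut F2 ⧸ Inn → MulAut F2 ⧸ Inn :=
  Quotient.map' (fun φ => j * φ * j⁻¹) (by
    intro φ ψ h
    rw [QuotientGroup.leftRel_apply] at h ⊢
    have h1 := conj_inner_mem h j
    simpa [mul_assoc] using h1)

theorem conjClass_conjClass (i j : MulAut F2) (h : i * j = 1) (c : MulAut F2 ⧸ Inn) :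
    conjClass i (conjClass j c) = c := by
  obtain ⟨φ, rfl⟩ := QuotientGroup.mk_surjective c
  have hi : i = j⁻¹ := eq_inv_of_mul_eq_one_left h
  subst hi
  change ((j⁻¹ * (j * φ * j⁻¹) * j⁻¹⁻¹ : MulAut F2) : MulAut F2 ⧸ Inn) = _
  simp [mul_assoc]

theorem conjClass_mem {j : MulAut F2} (hj : j ∈ J) {w v v' : F2} (hv : JRel v v')
    {c : MulAut F2 ⧸ Inn} (hc : c ∈ edgeClasses w v) :
    conjClass j c ∈ edgeClasses (j w) v' := by
  obtain ⟨φ, hφ, rfl, h⟩ := hc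
  obtain ⟨ψ, hψ, hi⟩ := conj_oneLetter hj φ hφ
  refine ⟨ψ, hψ, QuotientGroup.eq.2 hi, ?_⟩
  refine JRel.trans ?_ (h.trans hv)
  have h1 := conj_inner_mem hi ψ
  refine ⟨j⁻¹ * (ψ * (ψ⁻¹ * (j * φ * j⁻¹)) * ψ⁻¹), ?_, ?_⟩
  · exact J.mul_mem (J.inv_mem hj) (Subgroup.subset_closure (Or.inl h1))
  · rw [← MulAut.mul_apply, ← MulAut.mul_apply]
    congr 1
    group

/-- The number of edges does not depend on the representatives. -/
theorem encard_edgeClasses_congr {w v w' v' : F2} (hw : JRel w w') (hv : JRel v v') :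
    (edgeClasses w v).encard = (edgeClasses w' v').encard := by
  obtain ⟨j, hj, rfl⟩ := hw
  have himg : conjClass j '' edgeClasses w v = edgeClasses (j w) v' := by
    apply Set.Subset.antisymm
    · rintro _ ⟨c, hc, rfl⟩
      exact conjClass_mem hj hv hc
    · intro c hc
      refine ⟨conjClass j⁻¹ c, ?_, conjClass_conjClass _ _ (by simp) c⟩
      have h := conjClass_mem (J.inv_mem hj) hv.symm hc
      simpa using h
  rw [← himg]
  refine (Function.Injective.encard_image ?_ _).symm
  intro c d hcd
  have h := congrArg (conjClass j⁻¹) hcd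
  rwa [conjClass_conjClass _ _ (by simp), conjClass_conjClass _ _ (by simp)] at h

/-- The directed multigraph `Γ(W)`, given by its edge multiplicities: the number of edges from
`[w]` to `[v]` is the number of classes `[φ]` modulo inner automorphisms of one-letter
automorphisms `φ` with `φ w ∈ [v]`. -/
noncomputable def Gamma (W : Set F2) : Vertex W → Vertex W → ℕ∞ :=
  Quotient.lift₂ (fun w v => (edgeClasses w.1 v.1).encard)
    (fun _ _ _ _ hw hv => encard_edgeClasses_congr hw hv)

end F2

/-- Two directed multigraphs, given by edge multiplicities, are isomorphic. -/
def MultigraphIso {V V' : Type} (G : V → V → ℕ∞) (H : V' → V' → ℕ∞) : Prop :=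
  ∃ e : V ≃ V', ∀ u v : V, G u v = H (e u) (e v)

/-- The simple path on the `n + 1` vertices `0, …, n`: one edge in each direction between
consecutive vertices. For `n = 0` it is a single vertex without edges. -/
def simplePath (n : ℕ) (i j : Fin (n + 1)) : ℕ∞ :=
  if (i : ℕ) + 1 = j ∨ (j : ℕ) + 1 = i then 1 else 0

/-- The simple path on `n + 1` vertices with one loop added at the last vertex.
For `n = 0` it is a single vertex with one loop. -/
def loopedPath (n : ℕ) (i j : Fin (n + 1)) : ℕ∞ :=
  if i = Fin.last n ∧ j = Fin.last n then 1 else simplePath n i j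

/-- The simple path on `n + 1` vertices with a second edge added from the last vertex to the
last but one. For `n = 0` it is a single vertex with two loops. -/
def doubleEdgedPath : (n : ℕ) → Fin (n + 1) → Fin (n + 1) → ℕ∞
  | 0, _, _ => 2
  | n + 1, i, j => if (i : ℕ) = n + 1 ∧ (j : ℕ) = n then 2 else simplePath (n + 1) i j

/-!
Modulo inner automorphisms there are four one-letter automorphisms, represented by
`φ : a ↦ ab`, `ψ : b ↦ ba` and their inverses. If `A = (aa)`, `B = (bb)` and `D = (ab) - (ab⁻¹)`
are counted in a cyclically reduced conjugate of `w`, then `φ^±1` changes the cyclic length of `w`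
by `A ± D`, and `ψ^±1` changes it by `B ± D` (`exists_length_formula`). The proof writes `w`
cyclically as a product of syllables `a^±1 b^i` and observes that `φ^k` only changes the exponents
`i`, by `k * c` with `c ∈ {0, 1, -1}` depending on the signs of the two neighbouring `a`-letters.

*Peak reduction.* By Nielsen's theorem (`mem_JT`) `φ`, the permutations and the inner automorphisms
generate `Aut F₂`. As `A, B ≥ 0`, two moves of which one shortens a word and the other does not
lengthen it are `φ^ε, ψ^ε` with the same sign `ε`, or equal; and `φ^ε w`, `ψ^ε w` are themselves
one step apart (`step_move_move`). So every automorphic conjugate of a shortest word is reached from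
it without ever decreasing the length (`ascends_apply`), and any two shortest words are joined by
steps preserving the length.

*The fan.* A move of each kind preserving the least length would force `|D| = A = B`, that is, a
root word. In a non-root class the length-preserving steps from a shortest word `w` are therefore,
after exchanging `a` and `b`, only `φ^±1`, and this persists along the way (`IsFan`): all shortest
words are `φ^k w` up to `J`. By convexity of the length, `k` runs through an interval of integers.
If the length of `φ^k w` does not grow linearly, then all the shifts `c` vanish and `φ` fixes
the conjugacy class of `w` (`twist_fixes_or_growth`): the graph is one vertex with two loops.
Otherwise the interval is finite, `0, …, N` say, and an identification `φ^k w ∼_J φ^l w` is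
compatible with `φ`, hence induced by the identity or by the reflection `i ↦ N - i`
(`IsFiniteFan.eq_reflect`). Without the reflection the graph is the simple path; folding the path
at the middle of an edge (`N` odd) gives the looped path, and at a vertex (`N` even) the
double-edged path.
-/

/-- The least values of a convex function on the integers are taken on an interval. -/
theorem Int.eq_of_convex {f : ℤ → ℤ} {m : ℤ} (hm : ∀ k, m ≤ f k)
    (hc : ∀ k, 2 * f k ≤ f (k + 1) + f (k - 1)) {i j l : ℤ} (hi : f i = m) (hl : f l = m)
    (hij : i ≤ j) (hjl : j ≤ l) : f j = m := by
  induction j, hij using Int.leInduction with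
  | base => exact hi
  | succ j _ ih =>
    have hj := ih (by omega)
    by_contra hne
    have hlt : m < f (j + 1) := lt_of_le_of_ne (hm _) (Ne.symm hne)
    have key : ∀ n, j + 1 ≤ n → m < f n ∧ f (n - 1) < f n := by
      intro n hn
      induction n, hn using Int.leInduction with
      | base => rw [add_sub_cancel_right, hj]; exact ⟨hlt, hlt⟩
      | succ n _ ihn =>
        have := hc n
        rw [add_sub_cancel_right]
        omega
    have := (key l hjl).1
    omega

namespace F2

open FreeGroup hiding map_one map_mul map_inv

/-! ### Cyclic length -/

/-- The cyclic length of `g`: the length of the cyclically reduced words conjugate to `g`. -/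
def clen (g : F2) : ℕ := (reduceCyclically g.toWord).length

theorem reduceCyclically_eq_self {L : List Letter} (h : IsCyclicallyReduced L) :
    reduceCyclically L = L := by
  induction L using List.bidirectionalRec with
  | nil => simp
  | singleton => simp
  | cons_append x L y _ =>
    rw [reduceCyclically.cons_append, if_neg]
    · simp
    · rw [← List.cons_append, isCyclicallyReduced_cons_append_iff] at h
      rintro ⟨h1, h2⟩
      have := h.2 h1
      rw [this] at h2
      simp at h2

theorem clen_eq_length {g : F2} (h : IsCyclicallyReduced g.toWord) : clen g = length g := by
  rw [clen, reduceCyclically_eq_self h, length]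

theorem clen_mk {L : List Letter} (h : IsCyclicallyReduced L) : clen (mk L) = L.length := by
  rw [clen, toWord_mk, h.1.reduce_eq, reduceCyclically_eq_self h]

theorem clen_le_length (g : F2) : clen g ≤ length g := by
  have h := congrArg List.length (reduceCyclically.conj_conjugator_reduceCyclically g.toWord)
  simp only [List.length_append] at h
  rw [clen, length]
  omega

/-- Every element is conjugate to one represented by a cyclically reduced word. -/
theorem exists_conj_cyclicallyReduced (g : F2) :
    ∃ h : F2, IsCyclicallyReduced (h * g * h⁻¹).toWord := by
  have h := congrArg mk (reduceCyclically.conj_conjugator_reduceCyclically g.toWord)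
  have hc := reduceCyclically.isCyclicallyReduced (isReduced_toWord (x := g))
  rw [← mul_mk, ← mul_mk, ← inv_mk, mk_toWord] at h
  refine ⟨(mk (reduceCyclically.conjugator g.toWord))⁻¹, ?_⟩
  rw [show (mk (reduceCyclically.conjugator g.toWord))⁻¹ * g *
      ((mk (reduceCyclically.conjugator g.toWord))⁻¹)⁻¹ = mk (reduceCyclically g.toWord) by
    rw [inv_inv, mul_assoc, inv_mul_eq_iff_eq_mul, ← eq_mul_inv_iff_mul_eq]
    exact h.symm]
  rwa [toWord_mk, hc.1.reduce_eq]

theorem length_mul_le (g h : F2) : length (g * h) ≤ length g + length h := norm_mul_le g h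

theorem length_inv (g : F2) : length g⁻¹ = length g := norm_inv_eq

/-- The length of `g ^ n` grows like `n * clen g`. -/
theorem length_pow (g : F2) (n : ℕ) (hn : n ≠ 0) :
    length (g ^ n) = n * clen g + 2 * (reduceCyclically.conjugator g.toWord).length := by
  rw [length, toWord_pow, reduceCyclically.reduce_flatten_replicate isReduced_toWord, if_neg hn]
  simp [clen, invRev_length]
  ring

theorem clen_conj_le (h g : F2) : clen (h * g * h⁻¹) ≤ clen g := by
  by_contra! hlt
  set C := 2 * (reduceCyclically.conjugator g.toWord).length + 2 * length h
  have h1 := length_pow (h * g * h⁻¹) (C + 1) (by omega)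
  have h2 := length_pow g (C + 1) (by omega)
  rw [conj_pow] at h1
  have h3 := length_mul_le (h * g ^ (C + 1)) h⁻¹
  have h4 := length_mul_le h (g ^ (C + 1))
  rw [length_inv] at h3
  have h5 : (C + 1) * (clen g + 1) ≤ (C + 1) * clen (h * g * h⁻¹) := Nat.mul_le_mul_left _ hlt
  have h6 : (C + 1) * (clen g + 1) = (C + 1) * clen g + C + 1 := by ring
  omega

theorem clen_conj (h g : F2) : clen (h * g * h⁻¹) = clen g := by
  apply le_antisymm (clen_conj_le h g)
  have := clen_conj_le h⁻¹ (h * g * h⁻¹)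
  rwa [show h⁻¹ * (h * g * h⁻¹) * h⁻¹⁻¹ = g by group] at this

theorem exists_conj_length_eq (g : F2) :
    ∃ h : F2, IsCyclicallyReduced (h * g * h⁻¹).toWord ∧ length (h * g * h⁻¹) = clen g := by
  obtain ⟨h, hh⟩ := exists_conj_cyclicallyReduced g
  exact ⟨h, hh, by rw [← clen_eq_length hh, clen_conj]⟩

theorem IsPermutation.length_le {π : MulAut F2} (h : IsPermutation π) (g : F2) :
    length (π g) ≤ length g := by
  have key : ∀ L : List Letter, length (π (mk L)) ≤ L.length := by
    intro L
    induction L with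
    | nil =>
      rw [← one_eq_mk, map_one]
      simp [length]
    | cons x L ih =>
      have hx : π x.elt ∈ π '' Set.range Letter.elt := ⟨_, ⟨x, rfl⟩, rfl⟩
      rw [h] at hx
      obtain ⟨y, hy⟩ := hx
      have h1 := length_mul_le (π x.elt) (π (mk L))
      have h2 : length (π x.elt) = 1 := by rw [← hy]; rfl
      rw [← map_mul, Letter.elt, mul_mk] at h1
      rw [Letter.elt] at h2
      simp only [List.singleton_append] at h1
      rw [List.length_cons]
      omega
  have := key g.toWord
  rwa [mk_toWord] at this

theorem IsPermutation.clen_le {π : MulAut F2} (h : IsPermutation π) (g : F2) :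
    clen (π g) ≤ clen g := by
  obtain ⟨k, -, hk⟩ := exists_conj_length_eq g
  rw [← clen_conj (π k), ← map_inv, ← map_mul, ← map_mul, ← hk]
  exact (clen_le_length _).trans (h.length_le _)

theorem clen_of_mem_J {j : MulAut F2} (hj : j ∈ J) : ∀ g : F2, clen (j g) = clen g := by
  induction hj using Subgroup.closure_induction with
  | mem j hj =>
    rcases hj with ⟨h, rfl⟩ | hj
    · intro g
      rw [MulAut.conj_apply, clen_conj]
    · intro g
      apply le_antisymm (IsPermutation.clen_le hj g)
      have := (IsPermutation.inv hj).clen_le (j g)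
      rwa [MulAut.inv_apply_self] at this
  | one => intro g; rfl
  | mul i j _ _ hi hj => intro g; rw [MulAut.mul_apply, hi, hj]
  | inv i _ hi => intro g; rw [← hi, MulAut.apply_inv_self]

theorem JRel.clen_eq {w v : F2} (h : JRel w v) : clen w = clen v := by
  obtain ⟨j, hj, rfl⟩ := h
  exact (clen_of_mem_J hj w).symm

theorem jRel_conj (h g : F2) : JRel g (h * g * h⁻¹) :=
  ⟨MulAut.conj h, Subgroup.subset_closure (Or.inl ⟨h, rfl⟩), rfl⟩

/-- A word is minimal iff it is as long as the least cyclic length in its orbit. -/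
theorem isMinimal_iff {w : F2} :
    IsMinimal w ↔ length w = clen w ∧ ∀ θ : MulAut F2, clen w ≤ clen (θ w) := by
  constructor
  · intro h
    have h1 : length w = clen w := by
      obtain ⟨k, -, hk⟩ := exists_conj_length_eq w
      have := h (MulAut.conj k)
      rw [MulAut.conj_apply, hk] at this
      exact le_antisymm this (clen_le_length w)
    refine ⟨h1, fun θ => ?_⟩
    obtain ⟨k, -, hk⟩ := exists_conj_length_eq (θ w)
    rw [← h1, ← hk]
    exact h (MulAut.conj k * θ)
  · rintro ⟨h1, h2⟩ θ
    rw [h1]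
    exact (h2 θ).trans (clen_le_length _)

/-! ### The twist, the swap and the flip -/

theorem hom_ext_generators {f g : F2 →* F2} (ha : f a = g a) (hb : f b = g b) : f = g := by
  apply FreeGroup.ext_hom
  intro i
  fin_cases i
  · exact ha
  · exact hb

theorem aut_ext {f g : MulAut F2} (ha : f a = g a) (hb : f b = g b) : f = g := by
  have := hom_ext_generators (f := f.toMonoidHom) (g := g.toMonoidHom) ha hb
  ext x
  exact DFunLike.congr_fun this x

/-- The endomorphism with prescribed images of the generators. -/
def homOf (u v : F2) : F2 →* F2 := FreeGroup.lift ![u, v]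

@[simp] theorem homOf_a (u v : F2) : homOf u v a = u := by simp [homOf, a]

@[simp] theorem homOf_b (u v : F2) : homOf u v b = v := by simp [homOf, b]

/-- The one-letter automorphism `a ↦ a * b`, `b ↦ b`. -/
def twist : MulAut F2 :=
  MonoidHom.toMulEquiv (homOf (a * b) b) (homOf (a * b⁻¹) b)
    (hom_ext_generators (by simp) (by simp)) (hom_ext_generators (by simp) (by simp))

@[simp] theorem twist_a : twist a = a * b := homOf_a (a * b) b

@[simp] theorem twist_b : twist b = b := homOf_b (a * b) b

/-- The permutation exchanging `a` and `b`. -/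
def swap : MulAut F2 :=
  MonoidHom.toMulEquiv (homOf b a) (homOf b a)
    (hom_ext_generators (by simp) (by simp)) (hom_ext_generators (by simp) (by simp))

@[simp] theorem swap_a : swap a = b := homOf_a b a

@[simp] theorem swap_b : swap b = a := homOf_b b a

/-- The permutation inverting `b`. -/
def flip : MulAut F2 :=
  MonoidHom.toMulEquiv (homOf a b⁻¹) (homOf a b⁻¹)
    (hom_ext_generators (by simp) (by simp)) (hom_ext_generators (by simp) (by simp))

@[simp] theorem flip_a : flip a = a := homOf_a a b⁻¹

@[simp] theorem flip_b : flip b = b⁻¹ := homOf_b a b⁻¹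

theorem swap_mul_self : swap * swap = 1 := aut_ext (by simp) (by simp)

theorem inv_eq_of_apply_eq {θ : MulAut F2} {x y : F2} (h : θ y = x) : θ⁻¹ x = y := by
  rw [← h, MulAut.inv_apply_self]

theorem twist_zpow_b (k : ℤ) : (twist ^ k) b = b := by
  have h : twist ∈ MulAction.stabilizer (MulAut F2) b := twist_b
  exact Subgroup.zpow_mem _ h k

theorem twist_zpow_a (k : ℤ) : (twist ^ k) a = a * b ^ k := by
  induction k with
  | zero => simp
  | succ n ih =>
    rw [zpow_add, zpow_one, MulAut.mul_apply, twist_a, map_mul, ih, twist_zpow_b, zpow_add,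
      zpow_one, mul_assoc]
  | pred n ih =>
    rw [sub_eq_add_neg, zpow_add, zpow_neg_one, MulAut.mul_apply,
      inv_eq_of_apply_eq (show twist (a * b⁻¹) = a by simp), map_mul, ih, map_inv, twist_zpow_b,
      zpow_add, zpow_neg_one, mul_assoc]

theorem letter_elt_zero_true : Letter.elt (0, true) = a := rfl

theorem letter_elt_one_true : Letter.elt (1, true) = b := rfl

theorem letter_elt_zero_false : Letter.elt (0, false) = a⁻¹ := by
  rw [← letter_elt_zero_true, ← bar_elt]; rfl

theorem letter_elt_one_false : Letter.elt (1, false) = b⁻¹ := by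
  rw [← letter_elt_one_true, ← bar_elt]; rfl

theorem forall_letter {P : Letter → Prop} :
    (∀ z, P z) ↔ P (0, true) ∧ P (0, false) ∧ P (1, true) ∧ P (1, false) := by
  constructor
  · intro h
    exact ⟨h _, h _, h _, h _⟩
  · rintro ⟨h1, h2, h3, h4⟩ ⟨i, s⟩
    fin_cases i <;> cases s <;> assumption

theorem range_elt : Set.range Letter.elt = {a, a⁻¹, b, b⁻¹} := by
  ext g
  constructor
  · rintro ⟨z, rfl⟩
    revert z
    rw [forall_letter]
    simp [letter_elt_zero_true, letter_elt_one_true, letter_elt_zero_false, letter_elt_one_false]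
  · rintro (rfl | rfl | rfl | rfl)
    exacts [⟨_, letter_elt_zero_true⟩, ⟨_, letter_elt_zero_false⟩, ⟨_, letter_elt_one_true⟩,
      ⟨_, letter_elt_one_false⟩]

/-- An automorphism is a permutation if the images of the generators and their inverses are the
four letters. -/
theorem isPermutation_of {π : MulAut F2}
    (h : ({π a, (π a)⁻¹, π b, (π b)⁻¹} : Set F2) = {a, a⁻¹, b, b⁻¹}) : IsPermutation π := by
  rw [IsPermutation, range_elt]
  simpa only [Set.image_insert_eq, Set.image_singleton, map_inv] using h

theorem isPermutation_swap : IsPermutation swap :=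
  isPermutation_of (by ext; simp; tauto)

theorem isPermutation_flip : IsPermutation flip :=
  isPermutation_of (by ext; simp; tauto)

theorem IsPermutation.mem_J {π : MulAut F2} (h : IsPermutation π) : π ∈ J :=
  Subgroup.subset_closure (Or.inr h)

theorem inner_mem_J (h : F2) : MulAut.conj h ∈ J :=
  Subgroup.subset_closure (Or.inl ⟨h, rfl⟩)

/-! ### Syllables -/

/-- A syllable `(ε, i)` stands for `a ^ ε * b ^ i`, where `ε = ±1` is encoded by a Boolean. -/
abbrev Syllable : Type := Bool × ℤ

/-- The product of a list of syllables. -/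
def ev : List Syllable → F2
  | [] => 1
  | (s, i) :: S => Letter.elt (0, s) * b ^ i * ev S

/-- The sign of the first syllable, or `e` for the empty list. -/
def headSign (e : Bool) : List Syllable → Bool
  | [] => e
  | (s, _) :: _ => s

/-- The exponent of `b` that a twist creates between `a ^ s` and `a ^ t`. -/
def carry (s t : Bool) : ℤ := if s = t then (if s then 1 else -1) else 0

/-- The effect of `twist ^ k` on syllables; `e` is the sign of the letter `a ^ e` that follows the
list. -/
def shift (k : ℤ) (e : Bool) : List Syllable → List Syllable
  | [] => []
  | (s, i) :: S => (s, i + k * carry s (headSign e S)) :: shift k e S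

/-- No cancellation occurs between neighbouring syllables; `e` is the sign of the letter `a ^ e`
that follows the list. -/
def IsGood (e : Bool) : List Syllable → Prop
  | [] => True
  | (s, i) :: S => (s ≠ headSign e S → i ≠ 0) ∧ IsGood e S

theorem headSign_shift (k : ℤ) (e : Bool) (S : List Syllable) :
    headSign e (shift k e S) = headSign e S := by
  rcases S with _ | ⟨⟨s, i⟩, S⟩ <;> rfl

theorem IsGood.shift {e : Bool} {S : List Syllable} (k : ℤ) (h : IsGood e S) :
    IsGood e (shift k e S) := by
  induction S with
  | nil => trivial
  | cons x S ih =>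
    obtain ⟨s, i⟩ := x
    refine ⟨fun hs => ?_, ih h.2⟩
    rw [headSign_shift] at hs
    simpa [carry, hs] using h.1 hs

theorem twist_zpow_elt (k : ℤ) (s : Bool) : (twist ^ k) (Letter.elt (0, s)) =
    (if s then 1 else b ^ (-k)) * Letter.elt (0, s) * (if s then b ^ k else 1) := by
  cases s
  · simp [letter_elt_zero_false, twist_zpow_a]
  · simp [letter_elt_zero_true, twist_zpow_a]

theorem twist_zpow_ev (k : ℤ) (e : Bool) (S : List Syllable) :
    (twist ^ k) (ev S) * (if e then 1 else b ^ (-k)) =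
      (if headSign e S then 1 else b ^ (-k)) * ev (shift k e S) := by
  induction S with
  | nil => simp [ev, shift, headSign]
  | cons x S ih =>
    obtain ⟨s, i⟩ := x
    rw [ev, map_mul, map_mul, mul_assoc, ih, twist_zpow_elt, map_zpow, twist_zpow_b]
    rw [shift, ev, headSign, carry]
    generalize headSign e S = t
    cases s <;> cases t <;> simp [mul_assoc, zpow_add]
    · rw [← mul_assoc (b ^ k), ← zpow_add, add_comm, zpow_add, mul_assoc, mul_inv_cancel_left]
    · rw [← mul_assoc (b ^ k), ← zpow_add, add_comm, zpow_add, mul_assoc]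

/-- A list of syllables, closed up cyclically, is twisted by shifting its exponents. -/
theorem exists_conj_twist_zpow_ev (k : ℤ) (e : Bool) (S : List Syllable) (h : headSign e S = e) :
    ∃ u : F2, (twist ^ k) (ev S) = u * ev (shift k e S) * u⁻¹ := by
  have := twist_zpow_ev k e S
  rw [h] at this
  exact ⟨_, eq_mul_inv_of_mul_eq this⟩

/-- The reduced word of `b ^ i`. -/
def bword (i : ℤ) : List Letter := List.replicate i.natAbs (1, decide (0 ≤ i))

/-- The word spelled by a list of syllables. -/
def word : List Syllable → List Letter
  | [] => []
  | (s, i) :: S => (0, s) :: (bword i ++ word S)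

theorem mk_replicate (n : ℕ) (x : Letter) : mk (List.replicate n x) = x.elt ^ n := by
  rw [Letter.elt, pow_mk, List.flatten_replicate_singleton]

theorem mk_bword (i : ℤ) : mk (bword i) = b ^ i := by
  rw [bword, mk_replicate]
  rcases i.eq_nat_or_neg with ⟨n, rfl | rfl⟩
  · simp [letter_elt_one_true]
  · rcases Nat.eq_zero_or_pos n with rfl | hn
    · simp
    · simp [letter_elt_one_false, hn.ne']

theorem mk_word (S : List Syllable) : mk (word S) = ev S := by
  induction S with
  | nil => rfl
  | cons x S ih =>
    obtain ⟨s, i⟩ := x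
    rw [ev, ← ih, ← mk_bword, Letter.elt, mul_mk, mul_mk]
    simp [word]

theorem length_bword (i : ℤ) : (bword i).length = i.natAbs := by simp [bword]

theorem isReduced_replicate_append (n : ℕ) (y z : Letter) (L : List Letter) (hz : y.1 ≠ z.1)
    (h : IsReduced (z :: L)) : IsReduced (List.replicate n y ++ z :: L) := by
  induction n with
  | zero => exact h
  | succ n ih =>
    rw [List.replicate_succ, List.cons_append]
    rcases n with _ | n
    · simp only [List.replicate_zero, List.nil_append] at ih ⊢
      exact isReduced_cons_cons.2 ⟨fun h => absurd h hz, ih⟩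
    · rw [List.replicate_succ, List.cons_append] at ih ⊢
      exact isReduced_cons_cons.2 ⟨fun _ => rfl, ih⟩

/-- The word followed by `a ^ e` starts with a letter `a ^ ±1`. -/
theorem word_append_eq (e : Bool) (S : List Syllable) :
    ∃ L, word S ++ [((0, e) : Letter)] = (0, headSign e S) :: L := by
  rcases S with _ | ⟨⟨s, i⟩, S⟩
  · exact ⟨[], rfl⟩
  · exact ⟨_, rfl⟩

theorem IsGood.isReduced {e : Bool} {S : List Syllable} (h : IsGood e S) :
    IsReduced (word S ++ [((0, e) : Letter)]) := by
  induction S with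
  | nil => exact IsReduced.singleton
  | cons x S ih =>
    obtain ⟨s, i⟩ := x
    have h2 := ih h.2
    rw [word, List.cons_append, List.append_assoc]
    obtain ⟨L, hL⟩ := word_append_eq e S
    rw [hL] at h2 ⊢
    rw [bword]
    rcases hi : i.natAbs with _ | n
    · simp only [List.replicate_zero, List.nil_append]
      refine isReduced_cons_cons.2 ⟨fun _ => ?_, h2⟩
      by_contra hs
      exact h.1 hs (Int.natAbs_eq_zero.1 hi)
    · have h3 := isReduced_replicate_append (n + 1) ((1, decide (0 ≤ i)) : Letter) _ _
        (by simp) h2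
      rw [List.replicate_succ, List.cons_append] at h3 ⊢
      exact isReduced_cons_cons.2 ⟨fun h => by simp at h, h3⟩

theorem isCyclicallyReduced_of_append_head {x : Letter} {L : List Letter}
    (h : IsReduced (x :: L ++ [x])) : IsCyclicallyReduced (x :: L) := by
  refine ⟨h.infix ⟨[], [x], by simp⟩, ?_⟩
  intro y hy z hz
  simp only [List.head?_cons, Option.mem_some_iff] at hz
  subst hz
  have hy' := List.dropLast_append_getLast? y hy
  rw [← hy', List.append_assoc] at h
  have h4 : IsReduced [y, x] := h.infix ⟨_, [], by rw [List.append_nil]; rfl⟩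
  exact (isReduced_cons_cons.1 h4).1

theorem IsGood.isCyclicallyReduced {s : Bool} {i : ℤ} {S : List Syllable}
    (h : IsGood s ((s, i) :: S)) : IsCyclicallyReduced (word ((s, i) :: S)) :=
  isCyclicallyReduced_of_append_head h.isReduced

theorem bword_cons {s : Bool} {i : ℤ} {L : List Letter}
    (h : IsReduced (((1, s) : Letter) :: (bword i ++ L))) :
    ((1, s) : Letter) :: bword i = bword (i + if s then 1 else -1) := by
  rcases eq_or_ne i 0 with rfl | hi
  · cases s <;> rfl
  · have h1 : bword i =
        (1, decide (0 ≤ i)) :: List.replicate (i.natAbs - 1) (1, decide (0 ≤ i)) := by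
      rw [bword, ← List.replicate_succ]
      congr 1
      have := Int.natAbs_pos.2 hi
      omega
    have h2 : s = decide (0 ≤ i) := by
      rw [h1, List.cons_append] at h
      exact (isReduced_cons_cons.1 h).1 rfl
    subst h2
    rw [bword, ← List.replicate_succ, bword]
    by_cases h0 : 0 ≤ i
    · simp only [h0, decide_true, if_true]
      have h3 : 0 ≤ i + 1 := by omega
      rw [show (i + 1).natAbs = i.natAbs + 1 by omega]
      simp [h3]
    · have h3 : ¬ (0 ≤ i + -1) := by omega
      simp only [h0, decide_false, Bool.false_eq_true, if_false, h3]
      rw [show (i + -1).natAbs = i.natAbs + 1 by omega]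

/-- Splitting a reduced word into syllables. -/
theorem exists_syllables {e : Bool} {L : List Letter} (h : IsReduced (L ++ [((0, e) : Letter)])) :
    ∃ (i : ℤ) (S : List Syllable), L = bword i ++ word S ∧ IsGood e S := by
  induction L with
  | nil => exact ⟨0, [], rfl, trivial⟩
  | cons x L ih =>
    obtain ⟨i, S, rfl, hS⟩ := ih (h.infix ⟨[x], [], by simp⟩)
    obtain ⟨j, s⟩ := x
    rcases (by omega : j = 0 ∨ j = 1) with rfl | rfl
    · refine ⟨0, (s, i) :: S, rfl, ?_, hS⟩
      rintro hs rfl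
      obtain ⟨M, hM⟩ := word_append_eq e S
      simp only [bword, Int.natAbs_zero, List.replicate_zero, List.nil_append,
        List.cons_append] at h
      rw [hM] at h
      exact hs ((isReduced_cons_cons.1 h).1 rfl)
    · refine ⟨i + if s then 1 else -1, S, ?_, hS⟩
      rw [← List.cons_append, bword_cons (L := word S ++ [((0, e) : Letter)])]
      simpa using h

/-! ### Sums over the pairs of neighbouring letters -/

/-- The sum of `f x y` over the pairs `x y` of neighbouring letters of a word. -/
def psum (f : Letter → Letter → ℤ) : List Letter → ℤ
  | [] => 0
  | [_] => 0
  | x :: y :: L => f x y + psum f (y :: L)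

/-- The sum of `f x y` over the pairs `x y` of cyclically neighbouring letters of a word. -/
def csum (f : Letter → Letter → ℤ) (L : List Letter) : ℤ := psum f (L ++ L.take 1)

theorem csum_cons (f : Letter → Letter → ℤ) (x : Letter) (L : List Letter) :
    csum f (x :: L) = psum f (x :: L ++ [x]) := by simp [csum]

theorem psum_append (f : Letter → Letter → ℤ) (L : List Letter) (x : Letter) (M : List Letter) :
    psum f (L ++ x :: M) = psum f (L ++ [x]) + psum f (x :: M) := by
  induction L with
  | nil => simp [psum]
  | cons y L ih =>
    rcases L with _ | ⟨z, L⟩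
    · simp [psum]
    · simp only [List.cons_append, psum] at ih ⊢
      rw [ih, add_assoc]

theorem csum_rotate (f : Letter → Letter → ℤ) (L M : List Letter) :
    csum f (L ++ M) = csum f (M ++ L) := by
  rcases L with _ | ⟨x, L⟩
  · simp
  rcases M with _ | ⟨y, M⟩
  · simp
  rw [List.cons_append, List.cons_append, csum_cons, csum_cons]
  have h1 := psum_append f (x :: L) y (M ++ [x])
  have h2 := psum_append f (y :: M) x (L ++ [y])
  simp only [List.cons_append, List.append_assoc] at h1 h2 ⊢
  rw [h1, h2, add_comm]

theorem psum_map (f : Letter → Letter → ℤ) (s : Letter → Letter) (L : List Letter) :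
    psum f (L.map s) = psum (fun x y => f (s x) (s y)) L := by
  induction L with
  | nil => rfl
  | cons x L ih =>
    rcases L with _ | ⟨y, L⟩
    · rfl
    · simp only [List.map_cons, psum] at ih ⊢
      rw [ih]

theorem csum_map (f : Letter → Letter → ℤ) (s : Letter → Letter) (L : List Letter) :
    csum f (L.map s) = csum (fun x y => f (s x) (s y)) L := by
  rw [csum, ← List.map_take, ← List.map_append, psum_map, csum]

theorem psum_add (f g : Letter → Letter → ℤ) (L : List Letter) :
    psum (fun x y => f x y + g x y) L = psum f L + psum g L := by
  induction L with
  | nil => rfl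
  | cons x L ih =>
    rcases L with _ | ⟨y, L⟩
    · rfl
    · simp only [psum] at ih ⊢
      rw [ih]
      ring

theorem psum_smul (c : ℤ) (f : Letter → Letter → ℤ) (L : List Letter) :
    psum (fun x y => c * f x y) L = c * psum f L := by
  induction L with
  | nil => simp [psum]
  | cons x L ih =>
    rcases L with _ | ⟨y, L⟩
    · simp [psum]
    · simp only [psum] at ih ⊢
      rw [ih]
      ring

theorem psum_nonneg {f : Letter → Letter → ℤ} (h : ∀ x y, 0 ≤ f x y) (L : List Letter) :
    0 ≤ psum f L := by
  induction L with
  | nil => exact le_rfl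
  | cons x L ih =>
    rcases L with _ | ⟨y, L⟩
    · exact le_rfl
    · exact add_nonneg (h _ _) ih

/-- On a reduced word, a function that is a coboundary on all non-cancelling pairs telescopes. -/
theorem psum_telescope {f : Letter → Letter → ℤ} (p : Letter → ℤ)
    (h : ∀ x y : Letter, (x.1 = y.1 → x.2 = y.2) → f x y = p y - p x) (L : List Letter) :
    ∀ x y : Letter, IsReduced (x :: L ++ [y]) → psum f (x :: L ++ [y]) = p y - p x := by
  induction L with
  | nil =>
    intro x y hxy
    have := h x y (isReduced_cons_cons.1 hxy).1
    simp [psum, this]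
  | cons z L ih =>
    intro x y hxy
    have h1 := isReduced_cons_cons.1 hxy
    have := ih z y h1.2
    simp only [List.cons_append, psum] at this ⊢
    rw [this, h x z h1.1]
    ring

theorem isReduced_append_self {L : List Letter} (h : IsCyclicallyReduced L) :
    IsReduced (L ++ L) := by
  simpa [List.replicate_succ] using (h.flatten_replicate 2).isReduced

theorem isReduced_append_head {x : Letter} {L : List Letter} (h : IsCyclicallyReduced (x :: L)) :
    IsReduced (x :: L ++ [x]) :=
  (isReduced_append_self h).infix ⟨[], L, by simp⟩

theorem csum_telescope {f : Letter → Letter → ℤ} (p : Letter → ℤ)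
    (h : ∀ x y : Letter, (x.1 = y.1 → x.2 = y.2) → f x y = p y - p x) {L : List Letter}
    (hL : IsCyclicallyReduced L) : csum f L = 0 := by
  rcases L with _ | ⟨x, L⟩
  · rfl
  · rw [csum_cons, psum_telescope p h L x x (isReduced_append_head hL), sub_self]

theorem psum_replicate (f : Letter → Letter → ℤ) (x y z : Letter) (n : ℕ) (L : List Letter) :
    psum f (x :: (List.replicate (n + 1) y ++ z :: L)) =
      f x y + n * f y y + f y z + psum f (z :: L) := by
  induction n generalizing x with
  | zero => simp [psum]; ring
  | succ n ih =>
    rw [List.replicate_succ, List.cons_append, psum, ih]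
    push_cast
    ring

theorem psum_replicate_self (f : Letter → Letter → ℤ) (y : Letter) (h : f y y = 0) (n : ℕ) :
    psum f (List.replicate n y) = 0 := by
  induction n with
  | zero => rfl
  | succ n ih =>
    rcases n with _ | n
    · rfl
    · rw [List.replicate_succ, List.replicate_succ, psum, h, zero_add, ← List.replicate_succ, ih]

/-- The indicator of the two-letter words `x y` and `(x y)⁻¹`. -/
def pairInd (x y u v : Letter) : ℤ :=
  if (u = x ∧ v = y) ∨ (u = y.bar ∧ v = x.bar) then 1 else 0

theorem pairInd_nonneg (x y u v : Letter) : 0 ≤ pairInd x y u v := by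
  unfold pairInd
  split_ifs <;> simp

/-- The number of cyclic occurrences of the words `x y` and `(x y)⁻¹`. -/
def pairCount (x y : Letter) (L : List Letter) : ℤ := csum (pairInd x y) L

theorem pairCount_nonneg (x y : Letter) (L : List Letter) : 0 ≤ pairCount x y L :=
  psum_nonneg (pairInd_nonneg x y) _

/-- The contribution of a pair of neighbouring letters to the change of length under
`twist ^ k`, for `k = ±1`. -/
def twistGain (k : ℤ) (u v : Letter) : ℤ :=
  pairInd (0, true) (0, true) u v +
    k * (pairInd (0, true) (1, true) u v + -1 * pairInd (0, true) (1, false) u v)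

theorem csum_twistGain (k : ℤ) (L : List Letter) :
    csum (twistGain k) L = pairCount (0, true) (0, true) L +
      k * (pairCount (0, true) (1, true) L - pairCount (0, true) (1, false) L) := by
  unfold csum twistGain
  rw [psum_add, psum_smul, psum_add, psum_smul]
  unfold pairCount csum
  ring

theorem length_word_cons (s : Bool) (i : ℤ) (S : List Syllable) :
    ((word ((s, i) :: S)).length : ℤ) = 1 + |i| + (word S).length := by
  rw [word, List.length_cons, List.length_append, length_bword]
  push_cast
  ring

/-- The change of length of a good list of syllables under a twist. -/
theorem length_word_shift {k : ℤ} (hk : k = 1 ∨ k = -1) {e : Bool} {S : List Syllable}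
    (h : IsGood e S) : ((word (shift k e S)).length : ℤ) =
      (word S).length + psum (twistGain k) (word S ++ [((0, e) : Letter)]) := by
  induction S with
  | nil => rfl
  | cons x S ih =>
    obtain ⟨s, i⟩ := x
    rw [shift, length_word_cons, length_word_cons, ih h.2]
    obtain ⟨L, hL⟩ := word_append_eq e S
    rw [word, List.cons_append, List.append_assoc, hL]
    have h1 := h.1
    generalize headSign e S = t at *
    rw [bword]
    rcases hi : i.natAbs with _ | n
    · rw [Int.natAbs_eq_zero] at hi
      subst hi
      have hst : s = t := by
        by_contra hst
        exact h1 hst rfl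
      subst hst
      simp only [List.replicate_zero, List.nil_append, psum]
      have h2 : |k * carry s s| = twistGain k (0, s) (0, s) := by
        rcases hk with rfl | rfl <;> cases s <;> decide
      simp only [zero_add, abs_zero, h2]
      ring
    · rw [psum_replicate]
      have h2 : twistGain k (1, decide (0 ≤ i)) (1, decide (0 ≤ i)) = 0 := by
        rcases hk with rfl | rfl <;> cases decide (0 ≤ i) <;> decide
      have h3 : |i + k * carry s t| = |i| + (twistGain k (0, s) (1, decide (0 ≤ i)) +
          twistGain k (1, decide (0 ≤ i)) (0, t)) := by
        rcases lt_or_ge i 0 with h0 | h0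
        · rw [decide_eq_false (not_le.2 h0)]
          have h4 : twistGain k (0, s) (1, false) + twistGain k (1, false) (0, t) =
              - (k * carry s t) := by
            rcases hk with rfl | rfl <;> cases s <;> cases t <;> decide
          have h5 : i + k * carry s t ≤ 0 := by
            rcases hk with rfl | rfl <;> cases s <;> cases t <;> simp [carry] <;> omega
          rw [h4, abs_of_nonpos h5, abs_of_neg h0]
          ring
        · rw [decide_eq_true h0]
          have h0' : 0 < i := by omega
          have h4 : twistGain k (0, s) (1, true) + twistGain k (1, true) (0, t) =
              k * carry s t := by
            rcases hk with rfl | rfl <;> cases s <;> cases t <;> decide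
          have h5 : 0 ≤ i + k * carry s t := by
            rcases hk with rfl | rfl <;> cases s <;> cases t <;> simp [carry] <;> omega
          rw [h4, abs_of_nonneg h5, abs_of_nonneg h0]
      rw [h2, h3]
      ring

theorem clen_ev {e : Bool} {S : List Syllable} (h : headSign e S = e) (hS : IsGood e S) :
    clen (ev S) = (word S).length := by
  rw [← mk_word]
  rcases S with _ | ⟨⟨s, i⟩, S⟩
  · exact clen_mk (by simp [word])
  · change s = e at h
    subst h
    exact clen_mk hS.isCyclicallyReduced

theorem clen_twist_zpow_ev (k : ℤ) {e : Bool} {S : List Syllable} (h : headSign e S = e)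
    (hS : IsGood e S) : clen ((twist ^ k) (ev S)) = (word (shift k e S)).length := by
  obtain ⟨u, hu⟩ := exists_conj_twist_zpow_ev k e S h
  rw [hu, clen_conj]
  exact clen_ev ((headSign_shift k e S).trans h) (hS.shift k)

theorem mk_rotate (L M : List Letter) : mk (M ++ L) = (mk L)⁻¹ * mk (L ++ M) * (mk L)⁻¹⁻¹ := by
  rw [← mul_mk, ← mul_mk]
  group

/-- A cyclically reduced word is a power of `b`, or a rotation of the word of a good list of
syllables. -/
theorem cyclicallyReduced_eq_bword_or {L : List Letter} (h : IsCyclicallyReduced L) :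
    (∃ i, L = bword i) ∨ ∃ (M N : List Letter) (s : Bool) (i : ℤ) (S : List Syllable),
      L = M ++ N ∧ N ++ M = word ((s, i) :: S) ∧ IsGood s ((s, i) :: S) := by
  by_cases h0 : ∃ s, ((0, s) : Letter) ∈ L
  · right
    obtain ⟨s, hs⟩ := h0
    obtain ⟨M, N, rfl⟩ := List.append_of_mem hs
    have h1 : IsReduced (((0, s) : Letter) :: N ++ M ++ [((0, s) : Letter)]) :=
      (isReduced_append_self h).infix ⟨M, N, by simp⟩
    obtain ⟨i, S, hS, hg⟩ := exists_syllables h1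
    refine ⟨M, (0, s) :: N, ?_⟩
    have hi : i = 0 := by
      by_contra hi
      obtain ⟨n, hn⟩ := Nat.exists_eq_succ_of_ne_zero (Int.natAbs_ne_zero.2 hi)
      rw [bword, hn, List.replicate_succ] at hS
      simp at hS
    subst hi
    rcases S with _ | ⟨⟨t, j⟩, S⟩
    · simp [bword, word] at hS
    · have ht : s = t := by
        simpa [bword, word] using congrArg List.head? hS
      subst ht
      exact ⟨s, j, S, rfl, hS, hg⟩
  · left
    have h1 : IsReduced (L ++ [((0, true) : Letter)]) := by
      rw [FreeGroup.IsReduced, List.isChain_append]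
      refine ⟨h.1, List.isChain_singleton _, ?_⟩
      intro x hx y hy hxy
      simp only [List.head?_cons, Option.mem_some_iff] at hy
      subst hy
      exact absurd ⟨x.2, (by
        rw [show (((0 : Fin 2), x.2) : Letter) = x from Prod.ext hxy.symm rfl]
        exact List.mem_of_mem_getLast? hx)⟩ h0
    obtain ⟨i, S, rfl, -⟩ := exists_syllables h1
    rcases S with _ | ⟨⟨t, j⟩, S⟩
    · exact ⟨i, by simp [word]⟩
    · exact absurd ⟨t, by simp [word]⟩ h0

theorem csum_bword (k i : ℤ) : csum (twistGain k) (bword i) = 0 := by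
  have h2 : twistGain k (1, decide (0 ≤ i)) (1, decide (0 ≤ i)) = 0 := by
    cases decide (0 ≤ i) <;> simp [twistGain, pairInd, Letter.bar]
  rw [csum, bword, List.take_replicate, List.replicate_append_replicate, psum_replicate_self]
  exact h2

/-- The change of cyclic length under `twist` and its inverse. -/
theorem clen_twist_mk {k : ℤ} (hk : k = 1 ∨ k = -1) {L : List Letter}
    (h : IsCyclicallyReduced L) :
    (clen ((twist ^ k) (mk L)) : ℤ) = L.length + csum (twistGain k) L := by
  rcases cyclicallyReduced_eq_bword_or h with ⟨i, rfl⟩ | ⟨M, N, s, i, S, rfl, hS, hg⟩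
  · rw [csum_bword, mk_bword, map_zpow, twist_zpow_b, ← mk_bword, clen_mk h, add_zero]
  · have h1 := mk_rotate M N
    have h2 : clen ((twist ^ k) (mk (M ++ N))) = clen ((twist ^ k) (mk (N ++ M))) := by
      rw [h1, map_mul, map_mul, map_inv _ (mk M)⁻¹, map_inv, clen_conj]
    rw [h2, csum_rotate, hS, mk_word, clen_twist_zpow_ev k rfl hg, length_word_shift hk hg]
    congr 1
    · rw [← hS]
      simp [add_comm]

/-- Under the powers of `twist`, a cyclic word is either fixed or grows at least linearly. -/
theorem twist_fixes_or_growth (g : F2) : (∃ u : F2, twist g = u * g * u⁻¹) ∨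
    ∀ k : ℤ, |k| ≤ clen ((twist ^ k) g) + clen g := by
  have key : ∀ (e : Bool) (S : List Syllable), shift 1 e S = S ∨
      ∀ k : ℤ, |k| ≤ (word (shift k e S)).length + (word S).length := by
    intro e S
    induction S with
    | nil => exact Or.inl rfl
    | cons x S ih =>
      obtain ⟨s, i⟩ := x
      by_cases hc : carry s (headSign e S) = 0
      · rcases ih with ih | ih
        · left
          simp [shift, hc, ih]
        · right
          intro k
          rw [shift, length_word_cons, length_word_cons]
          have := ih k
          have := abs_nonneg i
          have := abs_nonneg (i + k * carry s (headSign e S))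
          omega
      · right
        intro k
        rw [shift, length_word_cons, length_word_cons]
        have h1 : |k| = |k * carry s (headSign e S)| := by
          have : |carry s (headSign e S)| = 1 := by
            revert hc
            generalize headSign e S = t
            cases s <;> cases t <;> decide
          rw [abs_mul, this, mul_one]
        have h2 := abs_sub (i + k * carry s (headSign e S)) i
        rw [add_sub_cancel_left, ← h1] at h2
        omega
  obtain ⟨v, hv⟩ := exists_conj_cyclicallyReduced g
  set g' := v * g * v⁻¹ with hg'
  have conj_reduce : ∀ (u g₁ g₂ : F2), g₂ = u * g₁ * u⁻¹ →
      ((∃ w : F2, twist g₂ = w * g₂ * w⁻¹) ∨ ∀ k : ℤ, |k| ≤ clen ((twist ^ k) g₂) + clen g₂) →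
      ((∃ w : F2, twist g₁ = w * g₁ * w⁻¹) ∨ ∀ k : ℤ, |k| ≤ clen ((twist ^ k) g₁) + clen g₁) := by
    rintro u g₁ _ rfl (⟨w, hw⟩ | hk)
    · left
      refine ⟨(twist u)⁻¹ * w * u, ?_⟩
      rw [map_mul, map_mul, map_inv] at hw
      have : twist g₁ = (twist u)⁻¹ * (twist u * twist g₁ * (twist u)⁻¹) * twist u := by group
      rw [this, hw]
      group
    · right
      simpa only [map_mul, map_inv, clen_conj] using hk
  refine conj_reduce v g g' hg' ?_
  rcases cyclicallyReduced_eq_bword_or hv with ⟨i, hi⟩ | ⟨M, N, s, i, S, hMN, hS, hg⟩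
  · left
    refine ⟨1, ?_⟩
    rw [← mk_toWord (x := g'), hi, mk_bword, map_zpow, twist_b]
    group
  · refine conj_reduce (mk M)⁻¹ g' (ev ((s, i) :: S)) ?_ ?_
    · rw [← mk_word, ← hS, mk_rotate M N, ← hMN, mk_toWord]
    · rcases key s ((s, i) :: S) with h | h
      · left
        obtain ⟨u, hu⟩ := exists_conj_twist_zpow_ev 1 s ((s, i) :: S) rfl
        rw [h, zpow_one] at hu
        exact ⟨u, hu⟩
      · right
        intro k
        rw [clen_twist_zpow_ev k rfl hg, clen_ev rfl hg]
        exact h k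

/-! ### Length changes under the one-letter automorphisms -/

/-- The action of `swap` on letters. -/
def swapLetter (x : Letter) : Letter := (Equiv.swap 0 1 x.1, x.2)

theorem swap_mk (L : List Letter) : swap (mk L) = mk (L.map swapLetter) := by
  have h : swap.toMonoidHom = FreeGroup.map (Equiv.swap (0 : Fin 2) 1) :=
    hom_ext_generators (swap_a.trans (by simp [a, b])) (swap_b.trans (by simp [a, b]))
  exact DFunLike.congr_fun h (mk L)

theorem isCyclicallyReduced_map_swapLetter {L : List Letter} (h : IsCyclicallyReduced L) :
    IsCyclicallyReduced (L.map swapLetter) := by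
  refine ⟨?_, ?_⟩
  · rw [FreeGroup.IsReduced, List.isChain_map]
    refine h.1.imp fun x y hxy hs => hxy ?_
    exact (Equiv.swap (0 : Fin 2) 1).injective hs
  · intro x hx y hy hxy
    rw [List.getLast?_map] at hx
    rw [List.head?_map] at hy
    obtain ⟨x', hx', rfl⟩ := Option.mem_map.1 hx
    obtain ⟨y', hy', rfl⟩ := Option.mem_map.1 hy
    exact h.2 x' hx' y' hy' ((Equiv.swap (0 : Fin 2) 1).injective hxy)

/-- The cyclic counts of `a * b` and of `b * a` agree. -/
theorem pairCount_swap {L : List Letter} (h : IsCyclicallyReduced L) :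
    pairCount (0, true) (1, true) (L.map swapLetter) = pairCount (0, true) (1, true) L := by
  have h1 : csum (fun x y => pairInd (0, true) (1, true) (swapLetter x) (swapLetter y) +
      -1 * pairInd (0, true) (1, true) x y) L = 0 := by
    -- The difference of the two counts is a coboundary on non-cancelling pairs of letters.
    refine csum_telescope
      (fun x => if x = (0, true) ∨ x = (1, false) then 1 else 0) ?_ h
    decide
  rw [csum, psum_add, psum_smul] at h1
  rw [pairCount, csum_map, pairCount, csum, csum]
  omega

theorem pairCount_swap' (L : List Letter) :
    pairCount (0, true) (1, false) (L.map swapLetter) = pairCount (0, true) (1, false) L := by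
  rw [pairCount, csum_map, pairCount]
  congr 1
  funext x y
  revert x y
  decide

theorem pairCount_swap_self (L : List Letter) :
    pairCount (0, true) (0, true) (L.map swapLetter) = pairCount (1, true) (1, true) L := by
  rw [pairCount, csum_map, pairCount]
  congr 1
  funext x y
  revert x y
  decide

theorem psum_eq_sum (f : Letter → Letter → ℤ) (F : List Letter → ℤ) (h : ∀ x y, F [x, y] = f x y)
    (M : List Letter) :
    psum f M = ∑ i ∈ Finset.range (M.length - 1), F ((M.drop i).take 2) := by
  induction M with
  | nil => rfl
  | cons x M ih =>
    rcases M with _ | ⟨y, M⟩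
    · rfl
    · simp only [List.length_cons, Nat.add_sub_cancel] at ih ⊢
      rw [Finset.sum_range_succ', psum, ih, add_comm]
      congr 1
      simp [h]

/-- For words of length at least two, `count` is the cyclic pair count. -/
theorem count_eq_pairCount {L : List Letter} (hL : IsReduced L) (h2 : 2 ≤ L.length)
    {x y : Letter} (hxy : x.1 = y.1 → x.2 = y.2) :
    (count (x.elt * y.elt) (mk L) : ℤ) = pairCount x y L := by
  have hw : (mk L).toWord = L := by rw [toWord_mk, hL.reduce_eq]
  have hu : (x.elt * y.elt).toWord = [x, y] := by
    rw [Letter.elt, Letter.elt, mul_mk, toWord_mk]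
    exact IsReduced.reduce_eq (isReduced_cons_cons.2 ⟨hxy, IsReduced.singleton⟩)
  have hu' : (x.elt * y.elt)⁻¹.toWord = [y.bar, x.bar] := by
    rw [toWord_inv, hu]
    rfl
  have hl : length (x.elt * y.elt) = 2 := by rw [length, hu]; rfl
  have hl' : length (mk L) = L.length := by rw [length, hw]
  rw [count, hl, hl', hw, hu, hu', if_pos h2, pairCount, csum,
    psum_eq_sum _ (fun M => if M = [x, y] ∨ M = [y.bar, x.bar] then 1 else 0)]
  · rw [Finset.card_filter]
    push_cast
    have h1 : (L ++ L.take 1).length - 1 = L.length := by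
      rw [List.length_append, List.length_take]
      omega
    rw [h1]
  · intro u v
    simp [pairInd]

theorem isRootWord_mk {L : List Letter} (hL : IsCyclicallyReduced L)
    (h2 : 2 ≤ L.length)
    (h : |pairCount (0, true) (1, true) L - pairCount (0, true) (1, false) L| =
      pairCount (0, true) (0, true) L)
    (h' : pairCount (0, true) (0, true) L = pairCount (1, true) (1, true) L) :
    IsRootWord (mk L) := by
  have e1 := count_eq_pairCount hL.1 h2 (x := (0, true)) (y := (1, true)) (by decide)
  have e2 := count_eq_pairCount hL.1 h2 (x := (0, true)) (y := (1, false)) (by decide)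
  have e3 := count_eq_pairCount hL.1 h2 (x := (0, true)) (y := (0, true)) (by decide)
  have e4 := count_eq_pairCount hL.1 h2 (x := (1, true)) (y := (1, true)) (by decide)
  rw [letter_elt_zero_true] at e1 e2 e3
  rw [letter_elt_one_true] at e1 e4
  rw [letter_elt_one_false] at e2
  refine ⟨?_, ?_, ?_⟩
  · rw [toWord_mk, hL.1.reduce_eq]
    exact hL
  · rw [e1, e2, e3, h]
  · have : (count (a * a) (mk L) : ℤ) = count (b * b) (mk L) := by rw [e3, e4, h']
    exact_mod_cast this

theorem isRootWord_one : IsRootWord 1 := by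
  refine ⟨by simp, ?_, ?_⟩ <;> simp [count, length]

/-- The length formula: the four one-letter automorphisms change the cyclic length of `g` by
`A ± D` and `B ± D`, where `A`, `B` and `D` are the numbers `(aa)`, `(bb)` and `(ab) - (ab⁻¹)` of
a cyclically reduced conjugate of `g`. -/
theorem exists_length_formula (g : F2) : ∃ A B D : ℤ, 0 ≤ A ∧ 0 ≤ B ∧
    (clen (twist g) : ℤ) = clen g + A + D ∧ (clen (twist⁻¹ g) : ℤ) = clen g + A - D ∧
    (clen (swap (twist (swap g))) : ℤ) = clen g + B + D ∧
    (clen (swap (twist⁻¹ (swap g))) : ℤ) = clen g + B - D ∧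
    (|D| = A → A = B → ∃ u : F2, IsRootWord (u * g * u⁻¹)) := by
  obtain ⟨u, hu⟩ := exists_conj_cyclicallyReduced g
  set L := (u * g * u⁻¹).toWord with hL
  have hg : mk L = u * g * u⁻¹ := mk_toWord
  have conj : ∀ θ : MulAut F2, clen (θ g) = clen (θ (mk L)) := by
    intro θ
    rw [hg, map_mul, map_mul, map_inv, clen_conj]
  have conj2 : ∀ θ : MulAut F2, clen (swap (θ (swap g))) = clen (swap (θ (swap (mk L)))) :=
    fun θ => conj (swap * θ * swap)
  have hlen : clen g = L.length := by rw [← clen_mk hu, hg, clen_conj]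
  have hs := isCyclicallyReduced_map_swapLetter hu
  have t1 := clen_twist_mk (k := 1) (Or.inl rfl) hu
  have t2 := clen_twist_mk (k := -1) (Or.inr rfl) hu
  have t3 := clen_twist_mk (k := 1) (Or.inl rfl) hs
  have t4 := clen_twist_mk (k := -1) (Or.inr rfl) hs
  rw [csum_twistGain] at t1 t2 t3 t4
  rw [pairCount_swap hu, pairCount_swap', pairCount_swap_self, List.length_map] at t3 t4
  rw [zpow_one] at t1 t3
  rw [zpow_neg_one] at t2 t4
  refine ⟨_, _, pairCount (0, true) (1, true) L - pairCount (0, true) (1, false) L,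
    pairCount_nonneg (0, true) (0, true) L, pairCount_nonneg (1, true) (1, true) L,
    ?_, ?_, ?_, ?_, ?_⟩
  · rw [conj, t1, hlen]; ring
  · rw [conj, t2, hlen]; ring
  · rw [conj2, clen_of_mem_J isPermutation_swap.mem_J, swap_mk, t3, hlen]; ring
  · rw [conj2, clen_of_mem_J isPermutation_swap.mem_J, swap_mk, t4, hlen]; ring
  · intro hA hB
    refine ⟨u, ?_⟩
    rw [← hg]
    rcases lt_or_ge L.length 2 with h | h
    · rcases L with _ | ⟨x, _ | ⟨y, L⟩⟩
      · exact isRootWord_one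
      · -- A single letter has exactly one of `(aa)` and `(bb)` cyclically equal to `1`.
        exfalso
        revert hB
        clear * -
        revert x
        decide
      · simp at h
    · exact isRootWord_mk hu h hA hB

/-! ### Common prefixes -/

/-- The length of the longest common prefix. -/
def lcp : List Letter → List Letter → ℕ
  | x :: L, y :: M => if x = y then lcp L M + 1 else 0
  | _, _ => 0

theorem lcp_nil (L : List Letter) : lcp L [] = 0 := by cases L <;> rfl

theorem lcp_comm (L M : List Letter) : lcp L M = lcp M L := by
  induction L generalizing M with
  | nil => rw [lcp_nil]; rfl
  | cons x L ih =>
    rcases M with _ | ⟨y, M⟩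
    · rfl
    · simp only [lcp, ih M, eq_comm (a := x)]

theorem lcp_ultrametric (L M N : List Letter) : min (lcp L M) (lcp M N) ≤ lcp L N := by
  induction L generalizing M N with
  | nil => simp [lcp]
  | cons x L ih =>
    rcases M with _ | ⟨y, M⟩
    · simp [lcp]
    rcases N with _ | ⟨z, N⟩
    · simp [lcp]
    simp only [lcp]
    by_cases h1 : x = y
    · by_cases h2 : y = z
      · subst h1 h2
        have := ih M N
        simp only [if_true]
        omega
      · simp [h2]
    · simp [h1]

theorem take_lcp (L M : List Letter) : L.take (lcp L M) = M.take (lcp L M) := by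
  induction L generalizing M with
  | nil => simp [lcp]
  | cons x L ih =>
    rcases M with _ | ⟨y, M⟩
    · simp [lcp]
    · by_cases h : x = y
      · simp [lcp, h, ih M]
      · simp [lcp, h]

theorem length_inv_mul {L M : List Letter} (hL : IsReduced L) (hM : IsReduced M) :
    length ((mk L)⁻¹ * mk M) + 2 * lcp L M = L.length + M.length := by
  induction L generalizing M with
  | nil => simp [← one_eq_mk, lcp, length, toWord_mk, hM.reduce_eq]
  | cons x L ih =>
    rcases M with _ | ⟨y, M⟩
    · rw [← one_eq_mk, mul_one, length_inv, lcp_nil, length, toWord_mk, hL.reduce_eq]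
      simp
    · by_cases h : x = y
      · subst h
        have h1 := ih (M := M) (hL.infix ⟨[x], [], by simp⟩)
          (hM.infix ⟨[x], [], by simp⟩)
        have h2 : (mk (x :: L))⁻¹ * mk (x :: M) = (mk L)⁻¹ * mk M := by
          rw [show mk (x :: L) = mk [x] * mk L from
              (mul_mk (L₁ := [x]) (L₂ := L)).symm,
            show mk (x :: M) = mk [x] * mk M from
              (mul_mk (L₁ := [x]) (L₂ := M)).symm]
          group
        rw [h2]
        simp only [lcp, if_true, List.length_cons]
        omega
      · have h1 : IsReduced (invRev (x :: L) ++ y :: M) := by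
          rw [FreeGroup.IsReduced, List.isChain_append]
          refine ⟨?_, hM, ?_⟩
          · have := isReduced_toWord (x := (mk (x :: L))⁻¹)
            rwa [toWord_inv, toWord_mk, hL.reduce_eq] at this
          · intro u hu v hv huv
            have hu' : u = x.bar := by simpa [invRev, eq_comm, Letter.bar] using hu
            simp only [List.head?_cons, Option.mem_some_iff] at hv
            subst hv
            subst hu'
            by_contra h3
            apply h
            refine Prod.ext huv ?_
            simp only [Letter.bar] at h3
            revert h3
            cases x.2 <;> cases y.2 <;> simp
        rw [inv_mk, mul_mk, length, toWord_mk, h1.reduce_eq]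
        simp [lcp, h, invRev_length]

/-- The Gromov product of two elements: the length of the common prefix of their reduced words. -/
def gp (g h : F2) : ℕ := lcp g.toWord h.toWord

theorem gp_comm (g h : F2) : gp g h = gp h g := lcp_comm _ _

theorem gp_ultrametric (g h k : F2) : min (gp g h) (gp h k) ≤ gp g k := lcp_ultrametric _ _ _

theorem length_inv_mul_add_gp (g h : F2) :
    length (g⁻¹ * h) + 2 * gp g h = length g + length h := by
  have := length_inv_mul (isReduced_toWord (x := g)) (isReduced_toWord (x := h))
  rwa [mk_toWord, mk_toWord] at this

theorem length_mul_add_gp (g h : F2) :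
    length (g * h) + 2 * gp g⁻¹ h = length g + length h := by
  have := length_inv_mul_add_gp g⁻¹ h
  rwa [inv_inv, length_inv] at this

theorem length_pos {g : F2} (h : g ≠ 1) : 0 < length g := by
  rw [Nat.pos_iff_ne_zero]
  exact fun h0 => h (norm_eq_zero.1 h0)

theorem clen_pos {g : F2} (h : g ≠ 1) : 0 < clen g := by
  rw [Nat.pos_iff_ne_zero]
  intro h0
  obtain ⟨u, -, hu⟩ := exists_conj_length_eq g
  rw [h0] at hu
  have : u * g * u⁻¹ = 1 := norm_eq_zero.1 hu
  exact h (conj_eq_one_iff.1 this)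

theorem gp_inv_self_lt {g : F2} (h : g ≠ 1) : 2 * gp g⁻¹ g < length g := by
  have h1 := length_pow g 2 (by omega)
  have h2 := length_pow g 1 (by omega)
  have h3 := length_mul_add_gp g g
  have h4 := clen_pos h
  rw [pow_one] at h2
  rw [pow_two] at h1
  omega

/-! ### Generation of the automorphism group -/

/-- The subgroup generated by the inner automorphisms, the permutations and the twist. -/
def JT : Subgroup (MulAut F2) := J ⊔ Subgroup.zpowers twist

theorem mem_JT_of_mem_J {j : MulAut F2} (h : j ∈ J) : j ∈ JT := Subgroup.mem_sup_left h

theorem twist_mem_JT : twist ∈ JT := Subgroup.mem_sup_right (Subgroup.mem_zpowers _)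

/-- Any two letters of different kinds are the images of `a` and `b` under a permutation. -/
theorem exists_permutation {x y : Letter} (h : x.1 ≠ y.1) :
    ∃ π ∈ J, π a = x.elt ∧ π b = y.elt := by
  have hs := isPermutation_swap.mem_J
  have hf := isPermutation_flip.mem_J
  have hg := J.mul_mem (J.mul_mem hs hf) hs
  revert x y
  simp only [forall_letter, letter_elt_zero_true, letter_elt_one_true, letter_elt_zero_false,
    letter_elt_one_false]
  refine ⟨⟨?_, ?_, ?_, ?_⟩, ⟨?_, ?_, ?_, ?_⟩, ⟨?_, ?_, ?_, ?_⟩, ⟨?_, ?_, ?_, ?_⟩⟩ <;> intro h <;>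
    first | exact absurd rfl h | clear h
  · exact ⟨1, J.one_mem, rfl, rfl⟩
  · exact ⟨_, hf, by simp, by simp⟩
  · exact ⟨_, hg, by simp, by simp⟩
  · exact ⟨_, J.mul_mem hg hf, by simp, by simp⟩
  · exact ⟨_, hs, by simp, by simp⟩
  · exact ⟨_, J.mul_mem hs hf, by simp, by simp⟩
  · exact ⟨_, J.mul_mem hf hs, by simp, by simp⟩
  · exact ⟨_, J.mul_mem (J.mul_mem hf hs) hf, by simp, by simp⟩

/-- The total length of the images of the generators. -/
def size (θ : MulAut F2) : ℕ := length (θ a) + length (θ b)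

/-- `θ` has least total length in its coset `θ * JT`. -/
def IsNielsenMinimal (θ : MulAut F2) : Prop := ∀ η ∈ JT, size θ ≤ size (θ * η)

theorem size_eq (θ : MulAut F2) {x y : Letter} (h : x.1 ≠ y.1) :
    size θ = length (θ x.elt) + length (θ y.elt) := by
  have ha : length (θ a⁻¹) = length (θ a) := by rw [map_inv, length_inv]
  have hb : length (θ b⁻¹) = length (θ b) := by rw [map_inv, length_inv]
  revert x y
  simp only [forall_letter, letter_elt_zero_true, letter_elt_one_true, letter_elt_zero_false,
    letter_elt_one_false, ha, hb, size]
  simp [add_comm]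

theorem take_invRev (L : List Letter) (n : ℕ) :
    (invRev L).take n = invRev (L.drop (L.length - n)) := by
  rw [invRev, invRev, ← List.map_reverse, ← List.map_reverse, ← List.map_take, List.take_reverse]

theorem apply_elt_ne_one (θ : MulAut F2) (x : Letter) : θ x.elt ≠ 1 := by
  rw [Ne, map_eq_one_iff θ θ.injective, ← toWord_eq_nil_iff]
  simp [Letter.elt]

namespace IsNielsenMinimal

variable {θ : MulAut F2}

theorem mul_mem_J (h : IsNielsenMinimal θ) {x y : Letter} (hxy : x.1 ≠ y.1) {π : MulAut F2}
    (hπ : π ∈ J) (hx : π a = x.elt) (hy : π b = y.elt) : IsNielsenMinimal (θ * π) := by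
  intro η hη
  have h1 : size (θ * π) = size θ := by
    rw [size_eq θ hxy, size, MulAut.mul_apply, MulAut.mul_apply, hx, hy]
  rw [h1, mul_assoc]
  exact h _ (JT.mul_mem (mem_JT_of_mem_J hπ) hη)

theorem le_length_mul (h : IsNielsenMinimal θ) {x y : Letter} (hxy : x.1 ≠ y.1) :
    length (θ x.elt) ≤ length (θ x.elt * θ y.elt) := by
  obtain ⟨π, hπ, hx, hy⟩ := exists_permutation hxy
  have h1 := h.mul_mem_J hxy hπ hx hy twist twist_mem_JT
  simp only [size, MulAut.mul_apply, twist_a, twist_b, map_mul, hx, hy] at h1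
  omega

theorem two_gp_le (h : IsNielsenMinimal θ) {x y : Letter} (hxy : x.1 ≠ y.1) :
    2 * gp (θ x.elt)⁻¹ (θ y.elt) ≤ length (θ x.elt) ∧
      2 * gp (θ x.elt)⁻¹ (θ y.elt) ≤ length (θ y.elt) := by
  have h1 := h.le_length_mul hxy
  have h2 := h.le_length_mul (x := y.bar) (y := x.bar) (by simpa [Letter.bar] using hxy.symm)
  have h3 := length_mul_add_gp (θ x.elt) (θ y.elt)
  rw [← map_mul, bar_elt, bar_elt, ← mul_inv_rev, map_inv, map_inv, length_inv, length_inv,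
    map_mul] at h2
  omega

/-- In `U * V * U`, the middle factor is not cancelled completely: otherwise `V = p * q` with
`U = q⁻¹ * m * p⁻¹`, and conjugating the pair `(U * V, V)` by `q` makes it shorter. -/
theorem not_both_half (h : IsNielsenMinimal θ) {x y : Letter} (hxy : x.1 ≠ y.1)
    (h1 : 2 * gp (θ x.elt)⁻¹ (θ y.elt) = length (θ y.elt))
    (h2 : 2 * gp (θ y.elt)⁻¹ (θ x.elt) = length (θ y.elt)) : False := by
  obtain ⟨π, hπ, hx, hy⟩ := exists_permutation hxy
  have hmin := h.mul_mem_J hxy hπ hx hy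
  have hU := (h.two_gp_le hxy).1
  have hV := length_pos (apply_elt_ne_one θ y)
  set U := θ x.elt with hUdef
  set V := θ y.elt with hVdef
  set n := gp U⁻¹ V with hn
  have hn2 : gp V⁻¹ U = n := by omega
  have hlV : V.toWord.length = 2 * n := h1.symm
  have hlU : 2 * n ≤ U.toWord.length := hU
  have t1 : U⁻¹.toWord.take n = V.toWord.take n := take_lcp _ _
  have t2 : V⁻¹.toWord.take n = U.toWord.take n := by
    rw [← hn2]
    exact take_lcp _ _
  set p := mk (V.toWord.take n)
  set q := mk (V.toWord.drop n)
  have hpq : V = p * q := by rw [mul_mk, List.take_append_drop, mk_toWord]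
  have hU1 : U.toWord.take n = invRev (V.toWord.drop n) := by
    rw [← t2, toWord_inv, take_invRev, hlV]
    congr 2
    omega
  have hU2 : U.toWord.drop (U.toWord.length - n) = invRev (V.toWord.take n) := by
    rw [← t1, toWord_inv, take_invRev, invRev_invRev]
  set m := mk ((U.toWord.drop n).take (U.toWord.length - 2 * n)) with hm
  have hU3 : U = q⁻¹ * m * p⁻¹ := by
    rw [inv_mk, inv_mk, ← hU1, ← hU2, mul_mk, mul_mk]
    conv_lhs => rw [← mk_toWord (x := U), ← List.take_append_drop n U.toWord,
      ← List.take_append_drop (U.toWord.length - 2 * n) (U.toWord.drop n), List.drop_drop]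
    rw [← List.append_assoc]
    congr 3
    omega
  have hmlen : length m ≤ U.toWord.length - 2 * n := norm_mk_le.trans (List.length_take_le _ _)
  have hqp : length (q * p) ≤ 2 * n := by
    refine (length_mul_le _ _).trans ((Nat.add_le_add norm_mk_le norm_mk_le).trans ?_)
    rw [List.length_take, List.length_drop]
    omega
  have e : θ * π * (MulAut.conj ((θ * π)⁻¹ q) * twist) = MulAut.conj q * (θ * π) * twist := by
    ext g
    simp [MulAut.conj_apply]
  have h3 := hmin (MulAut.conj ((θ * π)⁻¹ q) * twist)
    (JT.mul_mem (mem_JT_of_mem_J (inner_mem_J _)) twist_mem_JT)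
  rw [e] at h3
  simp only [size, MulAut.mul_apply, twist_a, twist_b, map_mul (θ * π), hx, hy,
    MulAut.conj_apply, ← hUdef, ← hVdef] at h3
  have e1 : q * (U * V) * q⁻¹ = m := by
    rw [hU3, hpq]
    group
  have e2 : q * V * q⁻¹ = q * p := by
    rw [hpq]
    group
  rw [e1, e2] at h3
  have h4 : length U = U.toWord.length := rfl
  omega

/-- No factor of a non-cancelling product of the images of letters is cancelled completely. -/
theorem gp_add_gp_lt (h : IsNielsenMinimal θ) {w x y : Letter} (hwx : w.1 = x.1 → w.2 = x.2)
    (hxy : x.1 = y.1 → x.2 = y.2) :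
    gp (θ w.elt)⁻¹ (θ x.elt) + gp (θ x.elt)⁻¹ (θ y.elt) < length (θ x.elt) := by
  have hself := gp_inv_self_lt (apply_elt_ne_one θ x)
  by_cases h1 : w.1 = x.1
  · have : w = x := Prod.ext h1 (hwx h1)
    subst this
    by_cases h2 : w.1 = y.1
    · have : w = y := Prod.ext h2 (hxy h2)
      subst this
      omega
    · have := (h.two_gp_le h2).1
      omega
  · by_cases h2 : x.1 = y.1
    · have : x = y := Prod.ext h2 (hxy h2)
      subst this
      have := (h.two_gp_le h1).2
      omega
    · have g1 := (h.two_gp_le h1).2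
      have g2 := (h.two_gp_le h2).1
      by_contra! hle
      by_cases h3 : w = y
      · subst h3
        exact h.not_both_half h1 (by omega) (by omega)
      · have : w = y.bar := by
          refine Prod.ext (by simp only [Letter.bar]; omega) ?_
          by_contra h4
          refine h3 (Prod.ext (by omega) ?_)
          simp only [Letter.bar] at h4
          revert h4
          cases w.2 <;> cases y.2 <;> simp
        subst this
        rw [bar_elt, map_inv, inv_inv] at hle g1
        have := gp_ultrametric (θ x.elt)⁻¹ (θ y.elt) (θ x.elt)
        omega

/-- By the ultrametric inequality and `gp_add_gp_lt`, the cancellation between `θ w` and the image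
of a reduced word `x ⋯` is that between `θ w` and `θ x`; in particular each letter of the word
contributes at least one letter to its image. -/
theorem le_length_apply (h : IsNielsenMinimal θ) (L : List Letter) :
    ∀ w x : Letter, (w.1 = x.1 → w.2 = x.2) → IsReduced (x :: L) →
      gp (θ w.elt)⁻¹ (θ (mk (x :: L))) = gp (θ w.elt)⁻¹ (θ x.elt) ∧
      gp (θ w.elt)⁻¹ (θ x.elt) + L.length + 1 ≤ length (θ (mk (x :: L))) := by
  induction L with
  | nil =>
    intro w x hwx _
    have := h.gp_add_gp_lt hwx (fun _ => rfl : x.1 = x.1 → x.2 = x.2)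
    refine ⟨rfl, ?_⟩
    change _ + 0 + 1 ≤ length (θ x.elt)
    rw [add_zero]
    exact (Nat.le_add_right _ _).trans_lt this
  | cons y L ih =>
    intro w x hwx hL
    have hxy := isReduced_cons_cons.1 hL
    obtain ⟨i1, i2⟩ := ih x y hxy.1 hxy.2
    have hP : θ (mk (x :: y :: L)) = θ x.elt * θ (mk (y :: L)) := by
      rw [← map_mul, Letter.elt, mul_mk]
      rfl
    have l1 := length_mul_add_gp (θ x.elt) (θ (mk (y :: L)))
    have l2 := length_inv_mul_add_gp (θ x.elt) (θ x.elt * θ (mk (y :: L)))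
    rw [inv_mul_cancel_left] at l2
    have n2 := h.gp_add_gp_lt hwx hxy.1
    have u1 := gp_ultrametric (θ w.elt)⁻¹ (θ x.elt) (θ x.elt * θ (mk (y :: L)))
    have u2 := gp_ultrametric (θ w.elt)⁻¹ (θ x.elt * θ (mk (y :: L))) (θ x.elt)
    rw [gp_comm (θ x.elt * θ (mk (y :: L))) (θ x.elt)] at u2
    rw [hP, List.length_cons]
    constructor <;> omega

theorem length_le (h : IsNielsenMinimal θ) (g : F2) : length g ≤ length (θ g) := by
  rcases hg : g.toWord with _ | ⟨x, L⟩
  · simp [length, hg]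
  · have h1 := (h.le_length_apply L x x (fun _ => rfl) (hg ▸ isReduced_toWord)).2
    rw [← hg, mk_toWord] at h1
    rw [length, hg, List.length_cons]
    omega

theorem exists_letter (h : IsNielsenMinimal θ) (x : Letter) : ∃ y : Letter, θ⁻¹ x.elt = y.elt := by
  have h1 := h.length_le (θ⁻¹ x.elt)
  rw [MulAut.apply_inv_self, show length x.elt = 1 from rfl] at h1
  have h2 := length_pos (apply_elt_ne_one θ⁻¹ x)
  obtain ⟨y, hy⟩ := List.length_eq_one_iff.1 (le_antisymm h1 h2)
  exact ⟨y, by rw [← mk_toWord (x := θ⁻¹ x.elt), hy, Letter.elt]⟩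

theorem inv_mem_J (h : IsNielsenMinimal θ) : θ⁻¹ ∈ J := by
  obtain ⟨x, hx⟩ := h.exists_letter (0, true)
  obtain ⟨y, hy⟩ := h.exists_letter (1, true)
  rw [letter_elt_zero_true] at hx
  rw [letter_elt_one_true] at hy
  have hxy : x.1 ≠ y.1 := by
    intro h1
    have h2 : x = y ∨ x = y.bar := by
      by_cases h3 : x.2 = y.2
      · exact Or.inl (Prod.ext h1 h3)
      · refine Or.inr (Prod.ext h1 ?_)
        simp only [Letter.bar]
        revert h3
        cases x.2 <;> cases y.2 <;> simp
    rcases h2 with rfl | rfl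
    · have := θ⁻¹.injective (hx.trans hy.symm)
      exact absurd (FreeGroup.of_injective this) (by decide)
    · rw [bar_elt, ← hy, ← map_inv] at hx
      have := congrArg toWord (θ⁻¹.injective hx)
      rw [← letter_elt_zero_true, ← letter_elt_one_true, ← bar_elt] at this
      simp [Letter.elt, Letter.bar] at this
  obtain ⟨π, hπ, h1, h2⟩ := exists_permutation hxy
  rwa [show θ⁻¹ = π from aut_ext (hx.trans h1.symm) (hy.trans h2.symm)]

end IsNielsenMinimal

/-- Nielsen's theorem: the automorphism group of the free group of rank two is generated by the
inner automorphisms, the permutations and the twist. -/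
theorem mem_JT (θ : MulAut F2) : θ ∈ JT := by
  induction hn : size θ using Nat.strong_induction_on generalizing θ with
  | _ n ih =>
    by_cases h : IsNielsenMinimal θ
    · have := JT.inv_mem (mem_JT_of_mem_J h.inv_mem_J)
      rwa [inv_inv] at this
    · unfold IsNielsenMinimal at h
      push Not at h
      obtain ⟨η, hη, hlt⟩ := h
      have h1 := ih _ (hn ▸ hlt) (θ * η) rfl
      have h2 := JT.mul_mem h1 (JT.inv_mem hη)
      rwa [mul_inv_cancel_right] at h2

/-! ### One-letter automorphisms modulo inner automorphisms -/

/-- The four one-letter automorphisms `twist`, `twist⁻¹` (for `t = false`) and their conjugates by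
`swap` (for `t = true`), which represent all one-letter automorphisms modulo inner ones. -/
def move (t s : Bool) : MulAut F2 :=
  let τ := if s then twist else twist⁻¹
  if t then swap * τ * swap else τ

theorem twist_inv_a : twist⁻¹ a = a * b⁻¹ := inv_eq_of_apply_eq (by simp)

theorem twist_inv_b : twist⁻¹ b = b := inv_eq_of_apply_eq (by simp)

theorem move_a (t s : Bool) : move t s a =
    if t then a else if s then a * b else a * b⁻¹ := by
  cases t <;> cases s <;> simp [move, -MulAut.inv_apply, twist_inv_a, twist_inv_b]

theorem move_b (t s : Bool) : move t s b =
    if t then (if s then b * a else b * a⁻¹) else b := by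
  cases t <;> cases s <;> simp [move, -MulAut.inv_apply, twist_inv_a, twist_inv_b]

theorem move_not (t s : Bool) : move t (!s) = (move t s)⁻¹ := by
  have h : swap⁻¹ = swap := inv_eq_of_mul_eq_one_left swap_mul_self
  cases t <;> cases s <;> simp [move, h, mul_assoc]

instance normal_inn : Inn.Normal := ⟨fun _ hn g => conj_inner_mem hn g⟩

theorem conj_mem_Inn (u : F2) : MulAut.conj u ∈ Inn := ⟨u, rfl⟩

theorem isOneLetter_move (t s : Bool) : IsOneLetter (move t s) := by
  refine ⟨{(if t then (1, true) else (0, true) : Letter)},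
    (if t then (0, s) else (1, s)), Finset.card_singleton _, ?_, ?_, ?_⟩
  · cases t <;> simp
  · cases t <;> simp [Letter.bar]
  · rw [forall_letter, letter_elt_zero_true, letter_elt_one_true, letter_elt_zero_false,
      letter_elt_one_false, map_inv, map_inv, move_a, move_b]
    cases t <;> cases s <;>
      simp [Letter.bar, letter_elt_zero_true, letter_elt_one_true, letter_elt_zero_false,
        letter_elt_one_false]

/-- Every one-letter automorphism agrees with one of the four moves modulo an inner
automorphism. -/
theorem IsOneLetter.exists_move {φ : MulAut F2} (h : IsOneLetter φ) :
    ∃ t s, ∃ u : F2, φ = move t s * MulAut.conj u := by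
  obtain ⟨A, x, hA, hx, hxb, hz⟩ := h
  obtain ⟨y, rfl⟩ := Finset.card_eq_one.1 hA
  simp only [Finset.mem_singleton] at hx hxb hz
  have ha := hz (0, true)
  have hb := hz (1, true)
  rw [letter_elt_zero_true] at ha
  rw [letter_elt_one_true] at hb
  clear hz hA
  suffices H : ∃ t s, ∃ u : F2, φ a = move t s (u * a * u⁻¹) ∧ φ b = move t s (u * b * u⁻¹) by
    obtain ⟨t, s, u, h1, h2⟩ := H
    exact ⟨t, s, u, aut_ext h1 h2⟩
  rw [ha, hb]
  clear ha hb
  simp only [map_mul, map_inv, move_a, move_b]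
  obtain ⟨i, p⟩ := x
  obtain ⟨j, q⟩ := y
  -- The inner automorphism is needed for `y ∈ {a⁻¹, b⁻¹}`; it is conjugation by `x⁻¹`.
  refine ⟨i = 0, p == q, if q then 1 else (Letter.elt (i, p))⁻¹, ?_⟩
  revert hx hxb
  fin_cases i <;> fin_cases j <;> cases p <;> cases q <;>
    simp [Letter.bar, letter_elt_zero_true, letter_elt_one_true, letter_elt_zero_false,
      letter_elt_one_false, move_a, move_b, mul_assoc]

theorem move_true_ne_move_false : (move false true : MulAut F2 ⧸ Inn) ≠ move false false := by
  intro h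
  obtain ⟨u, hu⟩ := QuotientGroup.eq.1 h
  have h1 : (MulAut.conj u) a = a * (b⁻¹ * b⁻¹) := by
    rw [hu, ← move_not, MulAut.mul_apply]
    simp [move_a, move_b, mul_assoc]
  have h2 := congrArg (FreeGroup.lift (fun i : Fin 2 => Multiplicative.ofAdd (i : ℤ))) h1
  have hb : FreeGroup.lift (fun i : Fin 2 => Multiplicative.ofAdd (i : ℤ)) b =
      Multiplicative.ofAdd (1 : ℤ) := by simp [b]
  rw [MulAut.conj_apply, map_mul, map_mul, map_inv, mul_right_comm, mul_inv_cancel, one_mul,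
    map_mul, left_eq_mul, map_mul, map_inv, hb] at h2
  exact absurd h2 (by decide)

/-! ### Steps -/

/-- `v` is obtained from `u` by a one-letter automorphism, up to `J`. -/
def Step (u v : F2) : Prop := (edgeClasses u v).Nonempty

theorem mem_edgeClasses_iff {u v : F2} {c : MulAut F2 ⧸ Inn} :
    c ∈ edgeClasses u v ↔ ∃ t s, (move t s : MulAut F2 ⧸ Inn) = c ∧ JRel (move t s u) v := by
  constructor
  · rintro ⟨φ, hφ, rfl, h⟩
    obtain ⟨t, s, g, rfl⟩ := hφ.exists_move
    refine ⟨t, s, ?_, ?_⟩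
    · rw [QuotientGroup.eq, inv_mul_cancel_left]
      exact conj_mem_Inn g
    · rw [MulAut.mul_apply, MulAut.conj_apply, map_mul, map_mul, map_inv] at h
      exact (jRel_conj _ _).trans h
  · rintro ⟨t, s, rfl, h⟩
    exact ⟨_, isOneLetter_move t s, rfl, h⟩

theorem step_iff {u v : F2} : Step u v ↔ ∃ t s, JRel (move t s u) v := by
  constructor
  · rintro ⟨c, hc⟩
    obtain ⟨t, s, -, h⟩ := mem_edgeClasses_iff.1 hc
    exact ⟨t, s, h⟩
  · rintro ⟨t, s, h⟩
    exact ⟨_, mem_edgeClasses_iff.2 ⟨t, s, rfl, h⟩⟩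

theorem Step.congr {u v u' v' : F2} (h : Step u v) (hu : JRel u u') (hv : JRel v v') :
    Step u' v' := by
  rw [Step, ← Set.encard_ne_zero, ← encard_edgeClasses_congr hu hv, Set.encard_ne_zero]
  exact h

theorem Step.symm {u v : F2} (h : Step u v) : Step v u := by
  obtain ⟨t, s, h⟩ := step_iff.1 h
  refine Step.congr (step_iff.2 ⟨t, !s, ?_⟩) h (JRel.refl u)
  rw [move_not, MulAut.inv_apply_self]
  exact JRel.refl u

/-- Two moves of different kinds and the same sign, such as `a ↦ ab` and `b ↦ ba`, lead to words that
are one step apart. -/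
theorem step_move_move (t s : Bool) (u : F2) : Step (move t s u) (move (!t) s u) := by
  have key : Step (move false s u) (move true s u) := by
    have hs := isPermutation_swap.mem_J
    have hf := isPermutation_flip.mem_J
    cases s
    · refine step_iff.2 ⟨true, true, _,
        J.mul_mem (J.mul_mem (inner_mem_J a) hs) hf, ?_⟩
      rw [← MulAut.mul_apply, ← MulAut.mul_apply]
      refine DFunLike.congr_fun (aut_ext ?_ ?_) u <;> simp [move_a, move_b, mul_assoc]
    · refine step_iff.2 ⟨true, false, _,
        J.mul_mem (J.mul_mem (inner_mem_J b) hf) hs, ?_⟩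
      rw [← MulAut.mul_apply, ← MulAut.mul_apply]
      refine DFunLike.congr_fun (aut_ext ?_ ?_) u <;> simp [move_a, move_b, mul_assoc]
  cases t
  · exact key
  · exact key.symm

/-- The length formula in terms of moves. -/
theorem exists_clen_move (g : F2) : ∃ A B D : ℤ, 0 ≤ A ∧ 0 ≤ B ∧
    (∀ t s, (clen (move t s g) : ℤ) = clen g + (if t then B else A) + if s then D else -D) ∧
    (|D| = A → A = B → ∃ u : F2, IsRootWord (u * g * u⁻¹)) := by
  obtain ⟨A, B, D, hA, hB, h1, h2, h3, h4, h5⟩ := exists_length_formula g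
  refine ⟨A, B, D, hA, hB, fun t s => ?_, h5⟩
  cases t <;> cases s
  · exact h2
  · exact h1
  · exact h4
  · exact h3

/-! ### Peak reduction -/

/-- `v` is reached from `w` by steps that never decrease the cyclic length. -/
inductive Ascends (w : F2) : F2 → Prop
  | base {v : F2} : JRel w v → Ascends w v
  | step {u v : F2} : Ascends w u → Step u v → clen u ≤ clen v → Ascends w v

/-- `w` has least cyclic length among its automorphic conjugates. -/
def IsShort (w : F2) : Prop := ∀ θ : MulAut F2, clen w ≤ clen (θ w)

variable {w : F2}

theorem Ascends.congr {u v : F2} (h : Ascends w u) (huv : JRel u v) : Ascends w v := by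
  cases h with
  | base h => exact .base (h.trans huv)
  | step h h1 h2 => exact .step h (h1.congr (JRel.refl _) huv) (huv.clen_eq ▸ h2)

/-- Peak reduction: at the top of a peak, two moves of which neither lengthens the word and one
shortens it have the same sign, so by `step_move_move` the peak can be cut off. -/
theorem Ascends.of_step (hw : IsShort w) {u : F2} (h : Ascends w u) :
    ∀ v, Step u v → Ascends w v := by
  induction h with
  | @base u h =>
    intro v hv
    refine .step (.base h) hv ?_
    obtain ⟨t, s, hts⟩ := step_iff.1 hv
    obtain ⟨j, hj, rfl⟩ := h
    rw [clen_of_mem_J hj, ← hts.clen_eq]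
    exact hw (move t s * j)
  | @step u' u h hu hle ih =>
    intro v hv
    rcases le_or_gt (clen u) (clen v) with hlt | hlt
    · exact .step (.step h hu hle) hv hlt
    obtain ⟨t, s, h1⟩ := step_iff.1 hv
    obtain ⟨t', s', h2⟩ := step_iff.1 hu.symm
    obtain ⟨A, B, D, hA, hB, hlen, -⟩ := exists_clen_move u
    have e1 := hlen t s
    have e2 := hlen t' s'
    rw [h1.clen_eq] at e1
    rw [h2.clen_eq] at e2
    by_cases hs : s = s'
    · subst hs
      by_cases ht : t = t'
      · subst ht
        exact h.congr (h2.symm.trans h1)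
      · obtain rfl : t = !t' := by revert ht; cases t <;> cases t' <;> simp
        exact ih v ((step_move_move t' s u).congr h2 h1)
    · exfalso
      obtain rfl : s = !s' := by revert hs; cases s <;> cases s' <;> simp
      cases s' <;> cases t <;> cases t' <;> simp at e1 e2 <;> omega

theorem ascends_apply (hw : IsShort w) (θ : MulAut F2) : Ascends w (θ w) := by
  let K : Subgroup (MulAut F2) :=
    { carrier := {η | ∀ u, Ascends w (η u) ↔ Ascends w u}
      one_mem' := fun u => Iff.rfl
      mul_mem' := fun {x y} hx hy u => (hx (y u)).trans (hy u)
      inv_mem' := fun {x} hx u => by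
        have := hx (x⁻¹ u)
        rw [MulAut.apply_inv_self] at this
        exact this.symm }
  have h1 : J ≤ K := fun j hj u =>
    ⟨fun h => h.congr (JRel.symm ⟨j, hj, rfl⟩), fun h => h.congr ⟨j, hj, rfl⟩⟩
  have h2 : twist ∈ K := fun u => by
    have hs : Step u (twist u) := step_iff.2 ⟨false, true, JRel.refl _⟩
    exact ⟨fun h => h.of_step hw _ hs.symm, fun h => h.of_step hw _ hs⟩
  have h3 : JT ≤ K := sup_le h1 (by rwa [Subgroup.zpowers_le])
  exact (h3 (mem_JT θ) w).2 (.base (JRel.refl w))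

/-! ### The fan of short words -/

/-- No automorphic conjugate of `w` is a root word. -/
def NoRoot (w : F2) : Prop := ∀ θ : MulAut F2, ¬ IsRootWord (θ w)

theorem NoRoot.apply (h : NoRoot w) (θ : MulAut F2) : NoRoot (θ w) := fun η => h (η * θ)

theorem IsShort.apply (h : IsShort w) {θ : MulAut F2} (hθ : clen (θ w) = clen w) :
    IsShort (θ w) := fun η => hθ ▸ h (η * θ)

/-- Without root words, the two kinds of moves cannot both preserve the least length. -/
theorem IsShort.clen_move_true_ne (h : IsShort w) (hr : NoRoot w) {s : Bool}
    (hs : clen (move false s w) = clen w) (s' : Bool) : clen (move true s' w) ≠ clen w := by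
  intro hs'
  obtain ⟨A, B, D, hA, hB, hlen, hroot⟩ := exists_clen_move w
  have e1 := hlen false s
  have e2 := hlen true s'
  have e3 := hlen false (!s)
  have e4 := hlen true (!s')
  have g1 := h (move false (!s))
  have g2 := h (move true (!s'))
  rw [hs] at e1
  rw [hs'] at e2
  suffices H : |D| = A ∧ A = B by
    obtain ⟨u, hu⟩ := hroot H.1 H.2
    exact hr (MulAut.conj u) hu
  cases s <;> cases s' <;> simp at e1 e2 e3 e4 g1 g2 <;> constructor <;> grind

/-- A short word without root words in its class which is lengthened by both moves of the second
kind. -/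
structure IsFan (w : F2) : Prop where
  short : IsShort w
  noRoot : NoRoot w
  ne : ∀ s, clen (move true s w) ≠ clen w

theorem IsFan.move (h : IsFan w) {s : Bool} (hs : clen (move false s w) = clen w) :
    IsFan (move false s w) := by
  have h1 := h.short.apply hs
  have h2 := h.noRoot.apply (F2.move false s)
  refine ⟨h1, h2, h1.clen_move_true_ne (s := !s) h2 ?_⟩
  rw [move_not, MulAut.inv_apply_self, hs]

theorem move_false_true : move false true = twist := rfl

theorem move_false_false : move false false = twist⁻¹ := rfl

theorem twist_zpow_add_apply (i j : ℤ) (w : F2) :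
    (twist ^ (i + j)) w = (twist ^ i) ((twist ^ j) w) := by rw [zpow_add, MulAut.mul_apply]

theorem two_mul_clen_le (w : F2) :
    2 * (clen w : ℤ) ≤ clen (twist w) + clen (twist⁻¹ w) := by
  obtain ⟨A, B, D, hA, hB, hlen, -⟩ := exists_clen_move w
  have e1 := hlen false true
  have e2 := hlen false false
  rw [move_false_true] at e1
  rw [move_false_false] at e2
  simp only [Bool.false_eq_true, if_false, if_true] at e1 e2
  omega

/-- The exponents `k` for which `twist ^ k` preserves the least length form an interval. -/
theorem IsShort.clen_twist_zpow_eq (h : IsShort w) {i j l : ℤ}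
    (hi : clen ((twist ^ i) w) = clen w) (hl : clen ((twist ^ l) w) = clen w)
    (hij : i ≤ j) (hjl : j ≤ l) : clen ((twist ^ j) w) = clen w := by
  have := Int.eq_of_convex (f := fun k => (clen ((twist ^ k) w) : ℤ)) (m := clen w)
    (fun k => by exact_mod_cast h _) (fun k => ?_) (by exact_mod_cast hi)
    (by exact_mod_cast hl) hij hjl
  · exact_mod_cast this
  · have := two_mul_clen_le ((twist ^ k) w)
    have e1 := twist_zpow_add_apply 1 k w
    have e2 := twist_zpow_add_apply (-1) k w
    rw [zpow_one, add_comm] at e1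
    rw [zpow_neg_one, add_comm, ← sub_eq_add_neg] at e2
    rwa [← e1, ← e2] at this

theorem IsFan.twist_zpow (h : IsFan w) {k : ℤ} (hk : clen ((twist ^ k) w) = clen w) :
    IsFan ((twist ^ k) w) := by
  induction k with
  | zero => simpa using h
  | succ n ih =>
    have h1 : clen ((twist ^ (n : ℤ)) w) = clen w :=
      h.short.clen_twist_zpow_eq (i := 0) (by simp) hk (by omega) (by omega)
    rw [add_comm, twist_zpow_add_apply, zpow_one] at hk ⊢
    exact (ih h1).move (s := true) (hk.trans h1.symm)
  | pred n ih =>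
    have h1 : clen ((twist ^ (-n : ℤ)) w) = clen w :=
      h.short.clen_twist_zpow_eq (l := 0) hk (by simp) (by omega) (by omega)
    rw [sub_eq_add_neg, add_comm, twist_zpow_add_apply, zpow_neg_one] at hk ⊢
    exact (ih h1).move (s := false) (hk.trans h1.symm)

/-- A step between short words starting in the fan is one of the two twists. -/
theorem IsFan.eq_false_of_clen_eq (h : IsFan w) {t s : Bool} (hts : clen (F2.move t s w) = clen w) :
    t = false := by
  cases t
  · rfl
  · exact absurd hts (h.ne s)

theorem move_false_eq_zpow (s : Bool) : move false s = twist ^ (if s then 1 else -1 : ℤ) := by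
  cases s <;> simp [move]

theorem IsFan.exists_jRel_of_ascends (h : IsFan w) {v : F2} (hv : Ascends w v)
    (hle : clen v ≤ clen w) : ∃ k : ℤ, JRel ((twist ^ k) w) v := by
  induction hv with
  | base hv => exact ⟨0, by simpa using hv⟩
  | @step u v _ huv huv' ih =>
    have hu : clen u ≤ clen w := huv'.trans hle
    obtain ⟨k, hk⟩ := ih hu
    have hkw : clen ((twist ^ k) w) = clen w := le_antisymm (hk.clen_eq ▸ hu) (h.short _)
    obtain ⟨t, s, hts⟩ := step_iff.1 (huv.congr hk.symm (JRel.refl v))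
    have h1 := h.twist_zpow hkw
    obtain rfl : t = false := by
      refine h1.eq_false_of_clen_eq (s := s) (le_antisymm ?_ (h1.short _))
      rw [hts.clen_eq, hkw]
      exact hle
    rw [move_false_eq_zpow, ← twist_zpow_add_apply] at hts
    exact ⟨_, hts⟩

/-- All short words in the class of a fan are twists of it, up to `J`. -/
theorem IsFan.exists_jRel (h : IsFan w) (θ : MulAut F2) (hle : clen (θ w) ≤ clen w) :
    ∃ k : ℤ, JRel ((twist ^ k) w) (θ w) :=
  h.exists_jRel_of_ascends (ascends_apply h.short θ) hle

theorem exists_isShort (w : F2) : ∃ θ : MulAut F2, IsShort (θ w) :=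
  ⟨Function.argmin fun θ : MulAut F2 => clen (θ w),
    fun η => Function.argmin_le (fun θ : MulAut F2 => clen (θ w)) (η * _)⟩

theorem exists_isFan (hr : NoRoot w) : ∃ θ : MulAut F2, IsFan (θ w) := by
  obtain ⟨θ, hθ⟩ := exists_isShort w
  have hr' := hr.apply θ
  by_cases h : ∃ s, clen (move true s (θ w)) = clen (θ w)
  · obtain ⟨s, hs⟩ := h
    have e : clen ((swap * θ) w) = clen (θ w) := clen_of_mem_J isPermutation_swap.mem_J _
    refine ⟨swap * θ, hθ.apply (θ := swap) e, hr.apply _, fun s' hs' => ?_⟩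
    refine hθ.clen_move_true_ne hr' (s := s') ?_ s hs
    rw [← e, ← hs', ← clen_of_mem_J isPermutation_swap.mem_J (move true s' _)]
    congr 1
    have h2 : swap * move true s' * swap = move false s' :=
      aut_ext (by cases s' <;> simp [move_a, move_b]) (by cases s' <;> simp [move_a, move_b])
    rw [← h2]
    rfl
  · push Not at h
    exact ⟨θ, hθ, hr', h⟩

open Classical in
theorem encard_setOf_eq_and {α : Type*} (x : α) (p : Prop) :
    {c | c = x ∧ p}.encard = if p then 1 else 0 := by
  by_cases h : p <;> simp [h]

/-- In a fan, the edges to a short word are given by the two twists. -/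
theorem IsFan.encard_edgeClasses (h : IsFan w) {v : F2} (hv : clen v = clen w) :
    (edgeClasses w v).encard =
      (open Classical in (if JRel (twist w) v then 1 else 0) +
        (if JRel (twist⁻¹ w) v then 1 else 0)) := by
  classical
  have h1 : edgeClasses w v = {c | c = (F2.move false true : MulAut F2 ⧸ Inn) ∧ JRel (twist w) v} ∪
      {c | c = (F2.move false false : MulAut F2 ⧸ Inn) ∧ JRel (twist⁻¹ w) v} := by
    ext c
    rw [mem_edgeClasses_iff]
    constructor
    · rintro ⟨t, s, rfl, hts⟩
      obtain rfl := h.eq_false_of_clen_eq (hts.clen_eq.trans hv)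
      cases s
      · exact Or.inr ⟨rfl, hts⟩
      · exact Or.inl ⟨rfl, hts⟩
    · rintro (⟨rfl, h⟩ | ⟨rfl, h⟩)
      exacts [⟨_, _, rfl, h⟩, ⟨_, _, rfl, h⟩]
  rw [h1, Set.encard_union_eq]
  · rw [encard_setOf_eq_and, encard_setOf_eq_and]
  · rw [Set.disjoint_left]
    rintro c ⟨rfl, -⟩ ⟨h2, -⟩
    exact move_true_ne_move_false h2

/-- An identification of two words of a fan by `J` comes from a translation or a reflection of the
exponents. -/
theorem exists_affine {v : F2} (hv : JRel w v) (hv' : IsFan v) {s : Bool}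
    (hs : clen (F2.move false s w) = clen w) :
    (∀ n : ℤ, JRel ((twist ^ n) w) ((twist ^ n) v)) ∨
      (∀ n : ℤ, JRel ((twist ^ n) w) ((twist ^ (-n)) v)) := by
  obtain ⟨j, hj, rfl⟩ := hv
  obtain ⟨ψ, hψ, hin⟩ := conj_oneLetter hj _ (isOneLetter_move false s)
  obtain ⟨t, s', u, rfl⟩ := hψ.exists_move
  have hin' : (F2.move t s')⁻¹ * (j * F2.move false s * j⁻¹) ∈ Inn := by
    have := Inn.mul_mem (conj_mem_Inn u) hin
    simpa [mul_assoc] using this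
  have hcl : ∀ {η η' : MulAut F2}, η⁻¹ * η' ∈ Inn → ∀ g, JRel (η g) (η' g) := by
    rintro η η' ⟨x, hx⟩ g
    have : η' = η * MulAut.conj x := by rw [hx, mul_inv_cancel_left]
    rw [this, MulAut.mul_apply, MulAut.conj_apply, map_mul, map_mul, map_inv]
    exact jRel_conj _ _
  have e1 : clen (F2.move t s' (j w)) = clen (j w) := by
    rw [(hcl hin' (j w)).clen_eq, MulAut.mul_apply, MulAut.inv_apply_self, MulAut.mul_apply,
      clen_of_mem_J hj, clen_of_mem_J hj, hs]
  obtain rfl := hv'.eq_false_of_clen_eq e1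
  have key : ∀ n : ℤ, JRel ((F2.move false s ^ n) w) ((F2.move false s' ^ n) (j w)) := by
    intro n
    have h1 : ((F2.move false s' ^ n : MulAut F2) : MulAut F2 ⧸ Inn) =
        (j * F2.move false s ^ n * j⁻¹ : MulAut F2) := by
      rw [← conj_zpow, QuotientGroup.mk_zpow, QuotientGroup.mk_zpow, QuotientGroup.eq.2 hin']
    have h2 := hcl (QuotientGroup.eq.1 h1) (j w)
    rw [MulAut.mul_apply, MulAut.inv_apply_self, MulAut.mul_apply] at h2
    exact (h2.trans (JRel.symm ⟨j, hj, rfl⟩)).symm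
  cases s <;> cases s'
  · left
    intro n
    simpa [move_false_false] using key (-n)
  · right
    intro n
    simpa [move_false_false, move_false_true] using key (-n)
  · right
    intro n
    simpa [move_false_false, move_false_true] using key n
  · left
    intro n
    simpa [move_false_true] using key n

/-! ### The shape of the graph -/

/-- To identify `Γ(W)`, it suffices to list short words of `W`, one for each vertex, and to count
the edges between them. -/
theorem multigraphIso_of {W : Set F2} (hW : ∀ x, x ∈ W ↔ ∃ θ : MulAut F2, θ w = x)
    (hw : IsShort w) {n : ℕ} (v : Fin (n + 1) → F2) (hv : ∀ i, v i ∈ W)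
    (hlen : ∀ i, clen (v i) = clen w) (inj : ∀ i j, JRel (v i) (v j) → i = j)
    (surj : ∀ θ : MulAut F2, clen (θ w) = clen w → ∃ i, JRel (v i) (θ w))
    (H : Fin (n + 1) → Fin (n + 1) → ℕ∞) (hH : ∀ i j, (edgeClasses (v i) (v j)).encard = H i j) :
    MultigraphIso (Gamma W) H := by
  have hrep : ∀ i, ∃ m : MinWord W, JRel (v i) m.1 := by
    intro i
    obtain ⟨u, -, hu⟩ := exists_conj_length_eq (v i)
    obtain ⟨θ, hθ⟩ := (hW _).1 (hv i)
    refine ⟨⟨u * v i * u⁻¹, (hW _).2 ⟨MulAut.conj u * θ, ?_⟩, ?_⟩, jRel_conj u (v i)⟩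
    · rw [MulAut.mul_apply, hθ, MulAut.conj_apply]
    · rw [isMinimal_iff, clen_conj]
      refine ⟨hu, fun η => ?_⟩
      rw [hlen, ← hθ]
      exact hw (η * MulAut.conj u * θ) |>.trans_eq (by
        rw [MulAut.mul_apply, MulAut.mul_apply, MulAut.conj_apply])
  choose m hm using hrep
  let f : Fin (n + 1) → Vertex W := fun i => Quotient.mk _ (m i)
  have hf : Function.Bijective f := by
    refine ⟨fun i j hij => inj i j ?_, fun x => ?_⟩
    · have : JRel (m i).1 (m j).1 := Quotient.exact hij
      exact ((hm i).trans this).trans (hm j).symm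
    · obtain ⟨⟨x, hx, hmin⟩, rfl⟩ := Quotient.exists_rep x
      obtain ⟨θ, rfl⟩ := (hW _).1 hx
      obtain ⟨i, hi⟩ := surj θ (by
        refine le_antisymm ?_ (hw θ)
        have := (isMinimal_iff.1 hmin).2 θ⁻¹
        rwa [MulAut.inv_apply_self] at this)
      exact ⟨i, Quotient.sound ((hm i).symm.trans hi)⟩
  refine ⟨(Equiv.ofBijective f hf).symm, fun x y => ?_⟩
  obtain ⟨i, rfl⟩ := hf.2 x
  obtain ⟨j, rfl⟩ := hf.2 y
  rw [Equiv.ofBijective_symm_apply_apply, Equiv.ofBijective_symm_apply_apply, ← hH]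
  exact encard_edgeClasses_congr (hm i).symm (hm j).symm

/-- If a twist fixes the conjugacy class of the word, then there is one vertex, with two loops. -/
theorem IsFan.multigraphIso_of_fixed (h : IsFan w) {W : Set F2}
    (hW : ∀ x, x ∈ W ↔ ∃ θ : MulAut F2, θ w = x) (hfix : ∃ u : F2, twist w = u * w * u⁻¹) :
    MultigraphIso (Gamma W) (doubleEdgedPath 0) := by
  obtain ⟨u, hu⟩ := hfix
  have h1 : JRel (twist w) w := by
    rw [hu]
    exact (jRel_conj u w).symm
  have hsucc : ∀ k : ℤ, JRel ((twist ^ (k + 1)) w) ((twist ^ k) w) := by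
    intro k
    rw [twist_zpow_add_apply, zpow_one, hu, map_mul, map_mul, map_inv]
    exact (jRel_conj _ _).symm
  have h2 : JRel (twist⁻¹ w) w := by
    have := hsucc (-1)
    rw [neg_add_cancel, zpow_zero, zpow_neg_one] at this
    exact this.symm
  refine multigraphIso_of hW h.short (fun _ => w) (fun _ => (hW w).2 ⟨1, rfl⟩) (fun _ => rfl)
    (fun i j _ => by omega) (fun θ hθ => ⟨0, ?_⟩) _ (fun i j => ?_)
  · obtain ⟨k, hk⟩ := h.exists_jRel θ hθ.le
    refine JRel.trans ?_ hk
    clear hk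
    induction k with
    | zero => exact JRel.refl w
    | succ n ih => exact ih.trans (hsucc _).symm
    | pred n ih =>
      have := hsucc (-(n : ℤ) - 1)
      rw [sub_add_cancel] at this
      exact ih.trans this
  · rw [h.encard_edgeClasses rfl, if_pos h1, if_pos h2]
    rfl

/-- A fan whose short words are exactly the twists with exponents `0, …, N`. -/
structure IsFiniteFan (w : F2) (N : ℕ) : Prop extends IsFan w where
  level : ∀ k : ℤ, clen ((twist ^ k) w) = clen w ↔ 0 ≤ k ∧ k ≤ N

/-- If no twist fixes the conjugacy class of the word, then the fan is finite. -/
theorem IsFan.exists_isFiniteFan (h : IsFan w)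
    (hgrow : ∀ k : ℤ, |k| ≤ clen ((twist ^ k) w) + clen w) :
    ∃ (θ : MulAut F2) (N : ℕ), IsFiniteFan (θ w) N := by
  have hbd : ∀ k : ℤ, clen ((twist ^ k) w) = clen w → |k| ≤ 2 * clen w := by
    intro k hk
    have := hgrow k
    rw [hk] at this
    omega
  obtain ⟨i, hi, hi'⟩ := Int.exists_least_of_bdd (P := fun k => clen ((twist ^ k) w) = clen w)
    ⟨-(2 * clen w), fun k hk => (abs_le.1 (hbd k hk)).1⟩ ⟨0, by simp⟩
  obtain ⟨l, hl, hl'⟩ := Int.exists_greatest_of_bdd (P := fun k => clen ((twist ^ k) w) = clen w)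
    ⟨2 * clen w, fun k hk => (abs_le.1 (hbd k hk)).2⟩ ⟨0, by simp⟩
  have hil := hi' l hl
  refine ⟨twist ^ i, (l - i).toNat, h.twist_zpow hi, fun k => ?_⟩
  rw [← twist_zpow_add_apply, hi, Int.toNat_of_nonneg (by omega)]
  constructor
  · intro hk
    have := hi' _ hk
    have := hl' _ hk
    omega
  · rintro ⟨h1, h2⟩
    exact h.short.clen_twist_zpow_eq hi hl (by omega) (by omega)

namespace IsFiniteFan

variable {N : ℕ}

/-- An identification of two different words of a finite fan is the reflection of the whole fan. -/
theorem eq_reflect (h : IsFiniteFan w N) {k l : ℤ} (hk : 0 ≤ k ∧ k ≤ N) (hl : 0 ≤ l ∧ l ≤ N)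
    (hkl : k ≠ l) (hR : JRel ((twist ^ k) w) ((twist ^ l) w)) :
    k + l = N ∧ ∀ i : ℤ, JRel ((twist ^ i) w) ((twist ^ (N - i)) w) := by
  have ek := (h.level k).2 hk
  have el := (h.level l).2 hl
  -- A neighbour of `k` in `0, …, N`.
  have hs : ∃ s, clen (F2.move false s ((twist ^ k) w)) = clen ((twist ^ k) w) := by
    rcases lt_or_ge k N with h1 | h1
    · refine ⟨true, ?_⟩
      rw [move_false_eq_zpow, ← twist_zpow_add_apply, ek, h.level, if_pos rfl]
      omega
    · refine ⟨false, ?_⟩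
      rw [move_false_eq_zpow, ← twist_zpow_add_apply, ek, h.level, if_neg (by simp)]
      omega
  obtain ⟨s, hs⟩ := hs
  have hiff : ∀ i j : ℤ, JRel ((twist ^ i) w) ((twist ^ j) w) →
      ((0 ≤ i ∧ i ≤ N) ↔ (0 ≤ j ∧ j ≤ N)) := by
    intro i j hij
    rw [← h.level, ← h.level, hij.clen_eq]
  rcases exists_affine hR (h.twist_zpow el) hs with hn | hn
  · -- A translation preserving `0, …, N` is trivial.
    exfalso
    have h1 := hn (-k)
    have h2 := hn (N - k)
    have h3 := hn (-l)
    rw [← twist_zpow_add_apply, ← twist_zpow_add_apply] at h1 h2 h3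
    have := hiff _ _ h1
    have := hiff _ _ h2
    have := hiff _ _ h3
    omega
  · have hn' : ∀ i : ℤ, JRel ((twist ^ i) w) ((twist ^ (k + l - i)) w) := by
      intro i
      have := hn (i - k)
      rw [← twist_zpow_add_apply, ← twist_zpow_add_apply] at this
      convert this using 3 <;> ring_nf
    have h1 := hiff _ _ (hn' 0)
    have h2 := hiff _ _ (hn' N)
    have hN : k + l = N := by omega
    refine ⟨hN, fun i => ?_⟩
    rw [← hN]
    exact hn' i

open Classical in
theorem encard_edgeClasses_twist (h : IsFiniteFan w N) {i j : ℤ} (hi : 0 ≤ i ∧ i ≤ N)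
    (hj : 0 ≤ j ∧ j ≤ N) : (edgeClasses ((twist ^ i) w) ((twist ^ j) w)).encard =
      (if JRel ((twist ^ (i + 1)) w) ((twist ^ j) w) then 1 else 0) +
        (if JRel ((twist ^ (i - 1)) w) ((twist ^ j) w) then 1 else 0) := by
  have hi' := (h.level i).2 hi
  have hj' := (h.level j).2 hj
  rw [(h.twist_zpow hi').encard_edgeClasses (hj'.trans hi'.symm), add_comm i 1, sub_eq_add_neg,
    add_comm i (-1), twist_zpow_add_apply, twist_zpow_add_apply, zpow_one, zpow_neg_one]

theorem range_of_jRel (h : IsFiniteFan w N) {i j : ℤ} (hj : 0 ≤ j ∧ j ≤ N)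
    (hR : JRel ((twist ^ i) w) ((twist ^ j) w)) : 0 ≤ i ∧ i ≤ N := by
  rw [← h.level, hR.clen_eq, h.level]
  exact hj

theorem exists_jRel_twist (h : IsFiniteFan w N) {θ : MulAut F2} (hθ : clen (θ w) = clen w) :
    ∃ k : ℤ, (0 ≤ k ∧ k ≤ N) ∧ JRel ((twist ^ k) w) (θ w) := by
  obtain ⟨k, hk⟩ := h.exists_jRel θ hθ.le
  exact ⟨k, (h.level k).1 (hk.clen_eq.trans hθ), hk⟩

/-- A finite fan, some of whose words may be identified, has one of the three shapes. -/
theorem multigraphIso (h : IsFiniteFan w N) {W : Set F2}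
    (hW : ∀ x, x ∈ W ↔ ∃ θ : MulAut F2, θ w = x) :
    (∃ n : ℕ, MultigraphIso (Gamma W) (simplePath n)) ∨
    (∃ n : ℕ, MultigraphIso (Gamma W) (loopedPath n)) ∨
    (∃ n : ℕ, MultigraphIso (Gamma W) (doubleEdgedPath n)) := by
  classical
  have hmem : ∀ k : ℤ, (twist ^ k) w ∈ W := fun k => (hW _).2 ⟨_, rfl⟩
  by_cases hex : ∃ k l : ℤ, (0 ≤ k ∧ k ≤ N) ∧ (0 ≤ l ∧ l ≤ N) ∧ k ≠ l ∧
      JRel ((twist ^ k) w) ((twist ^ l) w)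
  · obtain ⟨k, l, hk, hl, hkl, hR⟩ := hex
    have hrefl := (h.eq_reflect hk hl hkl hR).2
    have hiff : ∀ i j : ℤ, 0 ≤ j ∧ j ≤ N →
        (JRel ((twist ^ i) w) ((twist ^ j) w) ↔ i = j ∨ i + j = N) := by
      intro i j hj
      constructor
      · intro hij
        by_cases hne : i = j
        · exact Or.inl hne
        · exact Or.inr (h.eq_reflect (h.range_of_jRel hj hij) hj hne hij).1
      · rintro (rfl | hij)
        · exact JRel.refl _
        · have := hrefl i
          rwa [show (N : ℤ) - i = j by omega] at this
    right
    -- `n` is the last vertex of the folded path.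
    obtain ⟨n, hn⟩ : ∃ n, N = 2 * n + 1 ∨ N = 2 * n := ⟨N / 2, by omega⟩
    have iso : ∀ H : Fin (n + 1) → Fin (n + 1) → ℕ∞,
        (∀ i j : Fin (n + 1), ((if (i : ℤ) + 1 = j ∨ (i : ℤ) + 1 + j = N then 1 else 0) +
          (if (i : ℤ) - 1 = j ∨ (i : ℤ) - 1 + j = N then 1 else 0) : ℕ∞) = H i j) →
        MultigraphIso (Gamma W) H := by
      intro H hH
      refine multigraphIso_of hW h.short (fun i => (twist ^ (i : ℤ)) w) (fun i => hmem _)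
        (fun i => (h.level i).2 (by omega)) (fun i j hij => ?_) (fun θ hθ => ?_) H (fun i j => ?_)
      · rw [hiff _ _ (by omega)] at hij
        omega
      · obtain ⟨x, hx, hxR⟩ := h.exists_jRel_twist hθ
        by_cases hxn : x ≤ n
        · refine ⟨⟨x.toNat, by omega⟩, ?_⟩
          simpa [Int.toNat_of_nonneg hx.1] using hxR
        · refine ⟨⟨(N - x).toNat, by omega⟩, ?_⟩
          have h1 : ((N - x).toNat : ℤ) = N - x := Int.toNat_of_nonneg (by omega)
          simpa [h1] using (hrefl x).symm.trans hxR
      · rw [h.encard_edgeClasses_twist (by omega) (by omega), hiff _ _ (by omega),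
          hiff _ _ (by omega), ← hH]
        congr
    rcases hn with hn | hn
    · left
      refine ⟨n, iso _ fun i j => ?_⟩
      rw [loopedPath, simplePath]
      simp only [Fin.ext_iff, Fin.val_last]
      split_ifs <;> first | rfl | omega
    · right
      refine ⟨n, iso _ fun i j => ?_⟩
      rcases n with _ | n
      · omega
      · rw [doubleEdgedPath, simplePath]
        split_ifs <;> first | rfl | omega
  · push Not at hex
    left
    have hiff : ∀ i j : ℤ, 0 ≤ j ∧ j ≤ N →
        (JRel ((twist ^ i) w) ((twist ^ j) w) ↔ i = j) := by
      intro i j hj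
      constructor
      · intro hij
        by_contra hne
        exact hex i j (h.range_of_jRel hj hij) hj hne hij
      · rintro rfl
        exact JRel.refl _
    refine ⟨N, multigraphIso_of hW h.short (fun i => (twist ^ (i : ℤ)) w) (fun i => hmem _)
      (fun i => (h.level i).2 (by omega)) (fun i j hij => ?_) (fun θ hθ => ?_) _ (fun i j => ?_)⟩
    · rw [hiff _ _ (by omega)] at hij
      omega
    · obtain ⟨x, hx, hxR⟩ := h.exists_jRel_twist hθ
      refine ⟨⟨x.toNat, by omega⟩, ?_⟩
      simpa [Int.toNat_of_nonneg hx.1] using hxR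
    · rw [h.encard_edgeClasses_twist (by omega) (by omega), hiff _ _ (by omega),
        hiff _ _ (by omega), simplePath]
      split_ifs <;> first | rfl | omega

end IsFiniteFan

end F2

theorem theorem2 (W : Set F2) (hW : F2.IsNonRootClass W) :
    (∃ n : ℕ, MultigraphIso (F2.Gamma W) (simplePath n)) ∨
    (∃ n : ℕ, MultigraphIso (F2.Gamma W) (loopedPath n)) ∨
    (∃ n : ℕ, MultigraphIso (F2.Gamma W) (doubleEdgedPath n)) := by
  obtain ⟨⟨w, rfl⟩, hr⟩ := hW
  obtain ⟨θ, hθ⟩ := F2.exists_isFan (w := w) fun η => hr (η w) ⟨η, rfl⟩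
  have orbit : ∀ θ : MulAut F2, ∀ x, x ∈ {v | F2.AutConj w v} ↔ ∃ η : MulAut F2, η (θ w) = x := by
    intro θ x
    constructor
    · rintro ⟨η, rfl⟩
      exact ⟨η * θ⁻¹, by rw [MulAut.mul_apply, MulAut.inv_apply_self]⟩
    · rintro ⟨η, rfl⟩
      exact ⟨η * θ, rfl⟩
  rcases F2.twist_fixes_or_growth (θ w) with h | h
  · exact Or.inr (Or.inr ⟨0, hθ.multigraphIso_of_fixed (orbit θ) h⟩)
  · obtain ⟨η, N, hN⟩ := hθ.exists_isFiniteFan h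
    exact hN.multigraphIso (orbit (η * θ))
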